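/- Let $d\ge 3$. A map $\Phi$ from a set into a Euclidean space $\mathbb R^N$ is said to have generic multiplicity bounded by $l\in\mathbb N$ if $\operatorname{card}\Phi^{-1}(y)\le l$ for Lebesgue-almost every $y\in\mathbb R^N$. For an open set $\Omega\subset\mathbb R^{d-1}$ and a $C^2$ function $\phi:\Omega\to\mathbb R$ put $\gamma(x)=(x,\phi(x))\in\mathbb R^d$ for $x\in\Omega$, and let $\lambda$ be the affine surface measure on the graph $\gamma(\Omega)$, that is, the image under $\gamma$ of the measure $|\det H_\phi(x)|^{1/(d+1)}\,dx$ on $\Omega$, where $H_\phi$ is the Hessian of $\phi$. Let $$\Psi:\Omega^d\to(\mathbb R^d)^{d-1},\qquad \Psi(x_1,\dots,x_d)=\big(\gamma(x_1)-\gamma(x_2),\dots,\gamma(x_1)-\gamma(x_d)\big),$$ and let $q=\dfrac{4(d-1)}{d+1}$, $\ \|g\|_{L^{q,\infty}(\lambda)}=\sup_{t>0}t\,\lambda(\{|g|>t\})^{1/q}$. **Theorem.** For all $l,m\in\mathbb N$ there is a constant $C>0$, depending only on $d,l,m$, such that for every open $\Omega\subset\mathbb R^{d-1}$ and every $C^2$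 function $\phi$ on $\Omega$ for which $\operatorname{grad}\phi:\Omega\to\mathbb R^{d-1}$ has generic multiplicity bounded by $l$ and $\Psi$ has generic multiplicity bounded by $m$, the Fourier restriction estimate $$\|\hat f\|_{L^{q,\infty}(\lambda)}\le C\,\|f\|_{L^{4/3}(\mathbb R^d)}\qquad (1)$$ holds for all complex-valued $f\in L^{4/3}(\mathbb R^d)$. Here $\hat f$ is the Fourier integral $\hat f(\xi)=\int f(x)e^{-2\pi i x\cdot\xi}\,dx$ when $f\in L^1\cap L^{4/3}$. For general $f\in L^{4/3}$, $\hat f$ is understood $\lambda$-almost everywhere, through the unique linear extension of the map $f\mapsto\hat f$ from $L^1\cap L^{4/3}$ to $L^{4/3}$ that satisfies (1); the existence of this extension is part of the assertion. In particular, for every $N\in\mathbb N$ there is a constant $C>0$, depending only on $d$ and $N$, such that (1) holds in this sense for every open $\Omega\subset\mathbb R^{d-1}$ and every $\phi$ which is the restriction to $\Omega$ of a real polynomial on $\mathbb R^{d-1}$ of degree at most $N$. -/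

import Mathlib

open MeasureTheory
open scoped ENNReal NNReal FourierTransform

noncomputable section

namespace AffineRestriction

/-- Euclidean space `ℝ^k`. Below, `n = d - 1`: the domain `Ω` lies in `ℝ^n`, and the graph
lies in `ℝ^(n+1) = ℝ^d`. -/
abbrev Euc (k : ℕ) : Type := EuclideanSpace ℝ (Fin k)

/-- The restriction to `s` of the map `Φ` has generic multiplicity bounded by `l`: almost every
point `y` of the target (for its Lebesgue measure) has at most `l` preimages in `s`.
The cardinality `Set.encard` is `⊤` on infinite sets. -/
def GenericMultiplicityLE {α β : Type*} [MeasureSpace β] (Φ : α → β) (s : Set α) (l : ℕ) : Prop :=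
  ∀ᵐ y : β, (s ∩ Φ ⁻¹' {y}).encard ≤ (l : ℕ∞)

/-- The graph parametrization `γ(x) = (x, φ(x))`. -/
def graphMap {n : ℕ} (φ : Euc n → ℝ) (x : Euc n) : Euc (n + 1) :=
  WithLp.toLp 2 (Fin.snoc (α := fun _ => ℝ) (fun i => x i) (φ x))

/-- The `d`-fold product `Ω^d`, with `d = n + 1`. -/
def powSet {n : ℕ} (Ω : Set (Euc n)) : Set (Fin (n + 1) → Euc n) :=
  {X | ∀ i, X i ∈ Ω}

/-- `Ψ(x₁, …, x_d) = (γ(x₁) - γ(x₂), …, γ(x₁) - γ(x_d))`, with `d = n + 1`. -/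
def diffMap {n : ℕ} (φ : Euc n → ℝ) (X : Fin (n + 1) → Euc n) : Fin n → Euc (n + 1) :=
  fun j => graphMap φ (X 0) - graphMap φ (X j.succ)

/-- The Hessian determinant `det H_φ(x)`; the Hessian is the derivative of the gradient. -/
def hessianDet {n : ℕ} (φ : Euc n → ℝ) (x : Euc n) : ℝ :=
  (fderiv ℝ (gradient φ) x).det

/-- Affine surface measure `dλ = |det H_φ(x)|^(1/(d+1)) dx` (with `d = n + 1`) on the graph of
`φ` over `Ω`, as a Borel measure on `ℝ^d`. -/
def affineSurfaceMeasure {n : ℕ} (Ω : Set (Euc n)) (φ : Euc n → ℝ) : Measure (Euc (n + 1)) :=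
  ((volume.restrict Ω).withDensity
    (fun x => ENNReal.ofReal (|hessianDet φ x| ^ (1 / ((n : ℝ) + 2))))).map (graphMap φ)

/-- The weak `L^q` quasinorm `‖g‖_{L^{q,∞}(μ)} = sup_t t · μ {|g| > t}^(1/q)`. -/
def weakNorm {α : Type*} [MeasurableSpace α] (g : α → ℂ) (q : ℝ) (μ : Measure α) : ℝ≥0∞ :=
  ⨆ t : ℝ≥0, (t : ℝ≥0∞) * μ {x | t < ‖g x‖₊} ^ (1 / q)

/-- The restriction estimate `‖f̂‖_{L^{q,∞}(μ)} ≤ C ‖f‖_{L^p}` for all `f ∈ L^p(ℝ^k)`.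
For `f ∈ L^1 ∩ L^p` the function `f̂` is given by the Fourier integral. For general `f ∈ L^p`,
`f̂` on the support of `μ` is the value at `f` of a linear map `R` that satisfies the bound and
agrees with the Fourier integral on `L^1 ∩ L^p`; as `L^1 ∩ L^p` is dense in `L^p` (`p < ∞`),
there is at most one such `R`. -/
def RestrictionEstimate {k : ℕ} (μ : Measure (Euc k)) (p : ℝ≥0∞) (q : ℝ) (C : ℝ≥0) : Prop :=
  ∃ R : Lp ℂ p (volume : Measure (Euc k)) →ₗ[ℂ] (Euc k →ₘ[μ] ℂ),
    (∀ f : Lp ℂ p (volume : Measure (Euc k)), Integrable f volume →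
      (R f : Euc k → ℂ) =ᵐ[μ] 𝓕 (f : Euc k → ℂ)) ∧
    (∀ f : Lp ℂ p (volume : Measure (Euc k)),
      weakNorm (R f) q μ ≤ C * eLpNorm f p volume)

end AffineRestriction

end

open MeasureTheory Set
open scoped ENNReal NNReal FourierTransform Topology Matrix

namespace AffineRestriction

theorem tsum_indicator_one_le_encard {α β : Type*} {f : α → β} {s : Set α} {u : ℕ → Set α}
    (hus : ∀ i, u i ⊆ s) (hd : Pairwise (Function.onFun Disjoint u)) {m : ℕ} {y : β}
    (hm : (s ∩ f ⁻¹' {y}).encard ≤ (m : ℕ∞)) :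
    ∑' i, (f '' u i).indicator (1 : β → ℝ≥0∞) y ≤ m := by
  rw [ENNReal.tsum_eq_iSup_sum]
  refine iSup_le fun t => ?_
  classical
  have h1 : ∑ i ∈ t, (f '' u i).indicator (1 : β → ℝ≥0∞) y
      = ((t.filter fun i => y ∈ f '' u i).card : ℝ≥0∞) := by
    simp [Set.indicator_apply]
  rcases isEmpty_or_nonempty α with hα | hα
  · have : ∀ i, u i = ∅ := fun i => Set.eq_empty_of_isEmpty _
    simp [this]
  have h2 : ∀ i ∈ t.filter (fun i => y ∈ f '' u i), ∃ x, x ∈ u i ∧ f x = y := by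
    intro i hi
    simpa using (Finset.mem_filter.1 hi).2
  choose! g hg using h2
  have h3 : Set.InjOn g (t.filter fun i => y ∈ f '' u i) := by
    intro i hi j hj hij
    by_contra hne
    exact Set.disjoint_left.1 (hd hne) (hg i hi).1 (hij ▸ (hg j hj).1)
  rw [h1]
  have h4 : ((t.filter fun i => y ∈ f '' u i).card : ℕ∞) ≤ m := by
    rw [← Set.encard_coe_eq_coe_finsetCard, ← h3.encard_image]
    refine (Set.encard_le_encard ?_).trans hm
    rintro _ ⟨i, hi, rfl⟩
    exact ⟨hus i (hg i hi).1, (hg i hi).2⟩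
  exact_mod_cast h4

/-- The inequality in the area formula for a map of bounded generic multiplicity. -/
theorem setLIntegral_abs_det_mul_comp_le {E : Type*} [NormedAddCommGroup E] [NormedSpace ℝ E]
    [FiniteDimensional ℝ E] [MeasurableSpace E] [BorelSpace E] (μ : Measure E) [μ.IsAddHaarMeasure]
    {s : Set E} (hs : MeasurableSet s) {f : E → E} {f' : E → E →L[ℝ] E}
    (hf : ∀ x ∈ s, HasStrictFDerivAt f (f' x) x) (hdet : Measurable fun x => (f' x).det) {m : ℕ}
    (hm : ∀ᵐ y ∂μ, (s ∩ f ⁻¹' {y}).encard ≤ (m : ℕ∞)) {g : E → ℝ≥0∞} (hg : Measurable g) :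
    ∫⁻ x in s, ENNReal.ofReal |(f' x).det| * g (f x) ∂μ ≤ m * ∫⁻ y, g y ∂μ := by
  set s' : Set E := s ∩ {x | (f' x).det ≠ 0} with hs'
  have hs'm : MeasurableSet s' := hs.inter (hdet (measurableSet_singleton 0).compl)
  have hss' : s' ⊆ s := inter_subset_left
  have hinj : ∀ x ∈ s', ∃ u ∈ 𝓝 x, InjOn f u := by
    intro x hx
    have h1 := hf x hx.1
    let e : E ≃L[ℝ] E := (f' x).toContinuousLinearEquivOfDetNeZero hx.2
    have h2 : HasStrictFDerivAt f (e : E →L[ℝ] E) x := by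
      have : (e : E →L[ℝ] E) = f' x :=
        ContinuousLinearMap.coe_toContinuousLinearEquivOfDetNeZero _ _
      rwa [this]
    refine ⟨(h2.toOpenPartialHomeomorph f).source,
      (h2.toOpenPartialHomeomorph f).open_source.mem_nhds
        h2.mem_toOpenPartialHomeomorph_source, ?_⟩
    have := (h2.toOpenPartialHomeomorph f).injOn
    simpa using this
  choose! u hu huinj using hinj
  have hcover : ∃ v : ℕ → Set E, (∀ i, MeasurableSet (v i)) ∧ (∀ i, InjOn f (v i ∩ s')) ∧
      s' ⊆ ⋃ i, v i := by
    rcases s'.eq_empty_or_nonempty with h | hne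
    · exact ⟨fun _ => ∅, by simp, by simp [h], by simp [h]⟩
    obtain ⟨t, hts, htc, hst⟩ := TopologicalSpace.countable_cover_nhdsWithin
      (f := fun x => interior (u x)) (s := s')
      (fun x hx => mem_nhdsWithin_of_mem_nhds (interior_mem_nhds.2 (hu x hx)))
    have htne : t.Nonempty := by
      rcases t.eq_empty_or_nonempty with h | h
      · obtain ⟨x, hx⟩ := hne
        have := hst hx
        simp [h] at this
      · exact h
    obtain ⟨c, hc⟩ := htc.exists_eq_range htne
    refine ⟨fun i => interior (u (c i)), fun i => isOpen_interior.measurableSet, fun i => ?_, ?_⟩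
    · have : c i ∈ t := hc ▸ mem_range_self i
      exact (huinj _ (hts this)).mono (inter_subset_left.trans interior_subset)
    · intro x hx
      have := hst hx
      simpa [hc] using this
  obtain ⟨v, hvm, hvinj, hv⟩ := hcover
  set w : ℕ → Set E := fun i => disjointed v i ∩ s' with hw
  have hwm : ∀ i, MeasurableSet (w i) := fun i => (MeasurableSet.disjointed hvm i).inter hs'm
  have hwd : Pairwise (Function.onFun Disjoint w) := fun i j hij =>
    (disjoint_disjointed v hij).mono inter_subset_left inter_subset_left
  have hwu : ⋃ i, w i = s' := by
    rw [hw, ← iUnion_inter, iUnion_disjointed]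
    exact inter_eq_right.2 hv
  have hwinj : ∀ i, InjOn f (w i) := fun i => (hvinj i).mono
    (inter_subset_inter_left _ (disjointed_subset v i))
  have hws : ∀ i, w i ⊆ s := fun i => inter_subset_right.trans hss'
  have hwf : ∀ i, ∀ x ∈ w i, HasFDerivWithinAt f (f' x) (w i) x := fun i x hx =>
    (hf x (hws i hx)).hasFDerivAt.hasFDerivWithinAt
  have himg : ∀ i, MeasurableSet (f '' w i) := fun i =>
    measurable_image_of_fderivWithin (hwm i) (hwf i) (hwinj i)
  calc ∫⁻ x in s, ENNReal.ofReal |(f' x).det| * g (f x) ∂μ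
      = ∫⁻ x in s', ENNReal.ofReal |(f' x).det| * g (f x) ∂μ := by
        rw [← lintegral_indicator hs, ← lintegral_indicator hs'm]
        congr 1
        ext x
        by_cases hx : x ∈ s <;> by_cases hx' : (f' x).det = 0 <;>
          simp [hs', hx, hx']
    _ = ∑' i, ∫⁻ x in w i, ENNReal.ofReal |(f' x).det| * g (f x) ∂μ := by
        rw [← hwu, lintegral_iUnion hwm hwd]
    _ = ∑' i, ∫⁻ y, (f '' w i).indicator 1 y * g y ∂μ := by
        congr 1
        ext i
        rw [← lintegral_image_eq_lintegral_abs_det_fderiv_mul μ (hwm i) (hwf i) (hwinj i),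
          ← lintegral_indicator (himg i)]
        congr 1
        ext y
        by_cases hy : y ∈ f '' w i <;> simp [indicator_of_mem, indicator_of_notMem, hy]
    _ = ∫⁻ y, (∑' i, (f '' w i).indicator 1 y) * g y ∂μ := by
        rw [← lintegral_tsum]
        · simp_rw [ENNReal.tsum_mul_right]
        · exact fun i => ((measurable_one.indicator (himg i)).mul hg).aemeasurable
    _ ≤ ∫⁻ y, m * g y ∂μ := by
        refine lintegral_mono_ae ?_
        filter_upwards [hm] with y hy
        gcongr
        exact tsum_indicator_one_le_encard hws hwd hy
    _ = m * ∫⁻ y, g y ∂μ := lintegral_const_mul _ hg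

theorem ae_eval_ne_zero_fin : ∀ {n : ℕ} {p : MvPolynomial (Fin n) ℝ}, p ≠ 0 →
    ∀ᵐ x : Fin n → ℝ, MvPolynomial.eval x p ≠ 0 := by
  intro n
  induction n with
  | zero =>
    intro p hp
    refine Filter.Eventually.of_forall fun x hx => hp ?_
    refine MvPolynomial.funext fun y => ?_
    rw [Subsingleton.elim y x, hx, map_zero]
  | succ n ih =>
    intro p hp
    obtain ⟨i, hi⟩ : ∃ i, (MvPolynomial.finSuccEquiv ℝ n p).coeff i ≠ 0 := by
      by_contra! h
      apply hp
      apply (MvPolynomial.finSuccEquiv ℝ n).injective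
      ext1 i
      simp [h]
    have hmp := volume_preserving_piFinSuccAbove (fun _ : Fin (n + 1) => ℝ) 0
    have hcont : Measurable fun z : ℝ × (Fin n → ℝ) =>
        MvPolynomial.eval (Fin.cons z.1 z.2 : Fin (n + 1) → ℝ) p := by
      apply Continuous.measurable
      have h1 : Continuous fun z : ℝ × (Fin n → ℝ) => (Fin.cons z.1 z.2 : Fin (n + 1) → ℝ) := by
        refine continuous_pi fun j => ?_
        refine Fin.cases ?_ (fun j => ?_) j <;> simp only [Fin.cons_zero, Fin.cons_succ] <;>
          fun_prop
      exact (MvPolynomial.continuous_eval p).comp h1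
    have hms : MeasurableSet {z : (Fin n → ℝ) × ℝ |
        MvPolynomial.eval (Fin.cons z.2 z.1 : Fin (n + 1) → ℝ) p ≠ 0} :=
      (hcont.comp measurable_swap) (measurableSet_singleton 0).compl
    have key : ∀ᵐ z : (Fin n → ℝ) × ℝ,
        MvPolynomial.eval (Fin.cons z.2 z.1 : Fin (n + 1) → ℝ) p ≠ 0 := by
      rw [Measure.volume_eq_prod, Measure.ae_prod_iff_ae_ae hms]
      filter_upwards [ih hi] with s hs
      have hne : Polynomial.map (MvPolynomial.eval s) (MvPolynomial.finSuccEquiv ℝ n p) ≠ 0 := by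
        intro h
        apply hs
        have := congrArg (fun q => q.coeff i) h
        simpa using this
      have hfin : {t : ℝ | MvPolynomial.eval (Fin.cons t s : Fin (n + 1) → ℝ) p = 0}.Finite := by
        refine (Polynomial.map (MvPolynomial.eval s)
          (MvPolynomial.finSuccEquiv ℝ n p)).roots.toFinset.finite_toSet.subset fun t ht => ?_
        simp only [mem_ofPred_eq, MvPolynomial.eval_eq_eval_mv_eval'] at ht
        simpa [hne] using ht
      have := hfin.measure_zero volume
      simpa [ae_iff] using this
    have h2 : ∀ᵐ z : ℝ × (Fin n → ℝ),
        MvPolynomial.eval (Fin.cons z.1 z.2 : Fin (n + 1) → ℝ) p ≠ 0 :=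
      (Measure.measurePreserving_swap (μ := (volume : Measure ℝ))
        (ν := (volume : Measure (Fin n → ℝ)))).quasiMeasurePreserving.ae key
    filter_upwards [hmp.quasiMeasurePreserving.ae h2] with x hx
    convert hx using 2
    congr 1
    ext j
    refine Fin.cases ?_ (fun j => ?_) j <;> simp [MeasurableEquiv.piFinSuccAbove, Fin.tail]

theorem ae_eval_ne_zero {ι : Type*} [Fintype ι] {p : MvPolynomial ι ℝ} (hp : p ≠ 0) :
    ∀ᵐ x : ι → ℝ, MvPolynomial.eval x p ≠ 0 := by
  let e := Fintype.equivFin ι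
  have h1 : MvPolynomial.rename e p ≠ 0 := fun h =>
    hp ((MvPolynomial.rename_injective e e.injective) (by rw [h, map_zero]))
  have h2 := (volume_measurePreserving_piCongrLeft (fun _ => ℝ) e).quasiMeasurePreserving.ae
    (ae_eval_ne_zero_fin h1)
  filter_upwards [h2] with x hx
  rw [MvPolynomial.eval_rename] at hx
  convert hx
  ext i
  simp [MeasurableEquiv.piCongrLeft, Equiv.piCongrLeft]

/-- As many polynomials of degree `≤ N` as there are variables, and one further such polynomial `g`,
satisfy an algebraic relation whose degrees are bounded in terms of `N` and the number of
variables. -/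
theorem exists_relation {σ : Type*} [Fintype σ] [DecidableEq σ] (N : ℕ) (f : σ → MvPolynomial σ ℝ)
    (hf : ∀ j, (f j).totalDegree ≤ N) (g : MvPolynomial σ ℝ) (hg : g.totalDegree ≤ N) (a : ℕ)
    (ha : ((Fintype.card σ + 1) * N + 1) ^ Fintype.card σ ≤ a) :
    ∃ c : Fin (a + 1) × (σ → Fin (a + 1)) → ℝ, c ≠ 0 ∧
      ∑ b, MvPolynomial.C (c b) * (g ^ (b.1 : ℕ) * ∏ j, f j ^ (b.2 j : ℕ)) = 0 := by
  set k := Fintype.card σ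
  set M := ((k + 1) * N) * a with hM
  let F : Fin (a + 1) × (σ → Fin (a + 1)) → MvPolynomial σ ℝ := fun b =>
    g ^ (b.1 : ℕ) * ∏ j, f j ^ (b.2 j : ℕ)
  have hFdeg : ∀ b i, (F b).degreeOf i ≤ M := by
    intro b i
    refine (MvPolynomial.degreeOf_mul_le _ _ _).trans ?_
    have h1 : (g ^ (b.1 : ℕ)).degreeOf i ≤ a * N := by
      refine (MvPolynomial.degreeOf_pow_le _ _ _).trans ?_
      exact Nat.mul_le_mul (Nat.lt_succ_iff.1 b.1.2)
        ((MvPolynomial.degreeOf_le_totalDegree _ _).trans hg)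
    have h2 : (∏ j, f j ^ (b.2 j : ℕ)).degreeOf i ≤ ∑ _j : σ, a * N := by
      refine (MvPolynomial.degreeOf_prod_le _ _ _).trans (Finset.sum_le_sum fun j _ => ?_)
      refine (MvPolynomial.degreeOf_pow_le _ _ _).trans ?_
      exact Nat.mul_le_mul (Nat.lt_succ_iff.1 (b.2 j).2)
        ((MvPolynomial.degreeOf_le_totalDegree _ _).trans (hf j))
    rw [Finset.sum_const, Finset.card_univ, smul_eq_mul] at h2
    calc _ ≤ a * N + k * (a * N) := add_le_add h1 h2
      _ = M := by rw [hM]; ring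
  let T : (Fin (a + 1) × (σ → Fin (a + 1)) → ℝ) →ₗ[ℝ] ((σ → Fin (M + 1)) → ℝ) :=
    { toFun := fun c γ => ∑ b, c b * (F b).coeff (Finsupp.equivFunOnFinite.symm fun j => (γ j : ℕ))
      map_add' := fun c c' => by ext γ; simp [add_mul, Finset.sum_add_distrib]
      map_smul' := fun r c => by ext γ; simp [Finset.mul_sum, mul_assoc] }
  have hker : LinearMap.ker T ≠ ⊥ := by
    apply LinearMap.ker_ne_bot_of_finrank_lt
    simp only [Module.finrank_fintype_fun_eq_card, Fintype.card_prod, Fintype.card_fun,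
      Fintype.card_fin]
    calc (M + 1) ^ k ≤ (((k + 1) * N + 1) * (a + 1)) ^ k := by
          gcongr
          rw [hM]; nlinarith
      _ = ((k + 1) * N + 1) ^ k * (a + 1) ^ k := mul_pow _ _ _
      _ < (a + 1) * (a + 1) ^ k := by
          gcongr
          omega
  obtain ⟨c, hc, hc0⟩ := Submodule.exists_mem_ne_zero_of_ne_bot hker
  refine ⟨c, hc0, ?_⟩
  have hcoef : ∀ γ, (∑ b, MvPolynomial.C (c b) * F b).coeff γ = ∑ b, c b * (F b).coeff γ := by
    intro γ
    simp [MvPolynomial.coeff_sum, MvPolynomial.coeff_C_mul]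
  change ∑ b, MvPolynomial.C (c b) * F b = 0
  ext γ
  rw [hcoef, MvPolynomial.coeff_zero]
  by_cases hγ : ∀ j, γ j ≤ M
  · have := congrFun (LinearMap.mem_ker.1 hc) fun j => ⟨γ j, Nat.lt_succ_of_le (hγ j)⟩
    simp only [T, LinearMap.coe_mk, AddHom.coe_mk, Pi.zero_apply] at this
    convert this using 5
    ext j
    simp
  · push Not at hγ
    obtain ⟨j, hj⟩ := hγ
    refine Finset.sum_eq_zero fun b _ => ?_
    rw [MvPolynomial.notMem_support_iff.1, mul_zero]
    intro hmem
    exact absurd ((MvPolynomial.degreeOf_le_iff.1 (hFdeg b j)) γ hmem) (by omega)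

theorem ae_encard_image_eval_le {σ : Type*} [Fintype σ] (N : ℕ)
    (f : σ → MvPolynomial σ ℝ) (hf : ∀ j, (f j).totalDegree ≤ N) (g : MvPolynomial σ ℝ)
    (hg : g.totalDegree ≤ N) (a : ℕ)
    (ha : ((Fintype.card σ + 1) * N + 1) ^ Fintype.card σ ≤ a) :
    ∀ᵐ y : σ → ℝ, ((fun x => MvPolynomial.eval x g) ''
      {x : σ → ℝ | ∀ j, MvPolynomial.eval x (f j) = y j}).encard ≤ a := by
  classical
  obtain ⟨c, hc0, hc⟩ := exists_relation N f hf g hg a ha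
  let q : Fin (a + 1) → MvPolynomial σ ℝ := fun i =>
    ∑ β : σ → Fin (a + 1), MvPolynomial.monomial
      (Finsupp.equivFunOnFinite.symm fun j => (β j : ℕ)) (c (i, β))
  have hq : ∀ i y, MvPolynomial.eval y (q i)
      = ∑ β : σ → Fin (a + 1), c (i, β) * ∏ j, y j ^ (β j : ℕ) := by
    intro i y
    simp only [q, map_sum, MvPolynomial.eval_monomial]
    refine Finset.sum_congr rfl fun β _ => ?_
    rw [Finsupp.prod_fintype _ _ (by simp)]
    simp
  obtain ⟨⟨i, β⟩, hiβ⟩ := Function.ne_iff.1 hc0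
  have hqi : q i ≠ 0 := by
    intro h
    apply hiβ
    have := congrArg (MvPolynomial.coeff (Finsupp.equivFunOnFinite.symm fun j => (β j : ℕ))) h
    simp only [q, MvPolynomial.coeff_sum, MvPolynomial.coeff_monomial, MvPolynomial.coeff_zero]
      at this
    rw [Finset.sum_eq_single β] at this
    · simpa using this
    · intro β' _ hne
      rw [if_neg]
      intro h'
      apply hne
      ext j
      simpa using DFunLike.congr_fun h' j
    · simp
  filter_upwards [ae_eval_ne_zero hqi] with y hy
  let r : Polynomial ℝ := ∑ i : Fin (a + 1), Polynomial.C (MvPolynomial.eval y (q i)) *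
    Polynomial.X ^ (i : ℕ)
  have hr0 : r ≠ 0 := by
    intro h
    apply hy
    have := congrArg (fun p => Polynomial.coeff p i) h
    simp only [r, Polynomial.finsetSum_coeff, Polynomial.coeff_C_mul, Polynomial.coeff_X_pow,
      Polynomial.coeff_zero] at this
    rw [Finset.sum_eq_single i] at this
    · simpa using this
    · intro i' _ hne
      rw [if_neg (fun h => hne (Fin.ext h.symm)), mul_zero]
    · simp
  have hrdeg : r.natDegree ≤ a := by
    refine Polynomial.natDegree_sum_le_of_forall_le _ _ fun i _ => ?_
    exact (Polynomial.natDegree_C_mul_X_pow_le _ _).trans (Nat.lt_succ_iff.1 i.2)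
  have hsub : (fun x => MvPolynomial.eval x g) ''
      {x : σ → ℝ | ∀ j, MvPolynomial.eval x (f j) = y j} ⊆ r.roots.toFinset := by
    rintro _ ⟨x, hx, rfl⟩
    have h := congrArg (MvPolynomial.eval x) hc
    simp only [map_sum, map_mul, MvPolynomial.eval_C, map_pow, map_prod, map_zero,
      Fintype.sum_prod_type] at h
    rw [Finset.mem_coe, Multiset.mem_toFinset, Polynomial.mem_roots hr0, Polynomial.IsRoot]
    simp only [r, Polynomial.eval_finsetSum, Polynomial.eval_mul, Polynomial.eval_C, Polynomial.eval_pow,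
      Polynomial.eval_X, hq]
    rw [← h]
    refine Finset.sum_congr rfl fun i _ => ?_
    rw [Finset.sum_mul]
    refine Finset.sum_congr rfl fun β _ => ?_
    have : ∀ j, MvPolynomial.eval x (f j) = y j := hx
    simp only [this]
    ring
  refine (encard_le_encard hsub).trans ?_
  rw [encard_coe_eq_coe_finsetCard]
  exact_mod_cast (Multiset.toFinset_card_le _).trans ((Polynomial.card_roots' r).trans hrdeg)

/-- A polynomial map between spaces of the same dimension has generic multiplicity bounded in terms
of the dimension and of its degree. -/
theorem exists_ae_encard_fiber_le (σ : Type*) [Fintype σ] (N : ℕ) :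
    ∃ m : ℕ, ∀ f : σ → MvPolynomial σ ℝ, (∀ j, (f j).totalDegree ≤ N) →
      ∀ᵐ y : σ → ℝ, {x : σ → ℝ | ∀ j, MvPolynomial.eval x (f j) = y j}.encard ≤ (m : ℕ∞) := by
  classical
  set a := ((Fintype.card σ + 1) * (N + 1) + 1) ^ Fintype.card σ
  refine ⟨a ^ Fintype.card σ, fun f hf => ?_⟩
  have h : ∀ᵐ y : σ → ℝ, ∀ i : σ, ((fun x => MvPolynomial.eval x (MvPolynomial.X i)) ''
      {x : σ → ℝ | ∀ j, MvPolynomial.eval x (f j) = y j}).encard ≤ a :=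
    ae_all_iff.2 fun i => ae_encard_image_eval_le (N + 1) f (fun j => (hf j).trans (by omega)) _
      (by rw [MvPolynomial.totalDegree_X]; omega) a le_rfl
  filter_upwards [h] with y hy
  set S : σ → Set ℝ := fun i => (fun x => MvPolynomial.eval x (MvPolynomial.X i)) ''
      {x : σ → ℝ | ∀ j, MvPolynomial.eval x (f j) = y j}
  have hfin : ∀ i, (S i).Finite := fun i => finite_of_encard_le_coe (hy i)
  have hsub : {x : σ → ℝ | ∀ j, MvPolynomial.eval x (f j) = y j} ⊆
      (Fintype.piFinset fun i => (hfin i).toFinset : Finset (σ → ℝ)) := by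
    intro x hx
    simp only [Finset.mem_coe, Fintype.mem_piFinset, Finite.mem_toFinset]
    exact fun i => ⟨x, hx, by simp⟩
  refine (encard_le_encard hsub).trans ?_
  rw [encard_coe_eq_coe_finsetCard, Fintype.card_piFinset]
  have : ∏ i : σ, (hfin i).toFinset.card ≤ ∏ _i : σ, a := by
    refine Finset.prod_le_prod' fun i _ => ?_
    have := hy i
    rw [(hfin i).encard_eq_coe_toFinset_card] at this
    exact_mod_cast this
  rw [Finset.prod_const, Finset.card_univ] at this
  exact_mod_cast this

/-! ### Product measures -/

theorem measurePreserving_uncurry {ι κ : Type*} [Fintype ι] [Fintype κ] {X : Type*}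
    [MeasurableSpace X] (μ : Measure X) [SigmaFinite μ] :
    MeasurePreserving (fun (Z : ι → κ → X) (p : ι × κ) => Z p.1 p.2)
      (Measure.pi fun _ => Measure.pi fun _ => μ) (Measure.pi fun _ => μ) := by
  have hmeas : Measurable (fun (Z : ι → κ → X) (p : ι × κ) => Z p.1 p.2) := by fun_prop
  refine ⟨hmeas, (Measure.pi_eq fun s hs => ?_).symm⟩
  rw [Measure.map_apply hmeas (MeasurableSet.univ_pi hs)]
  have : (fun (Z : ι → κ → X) (p : ι × κ) => Z p.1 p.2) ⁻¹' (univ.pi s)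
      = univ.pi fun i => univ.pi fun j => s (i, j) := by
    ext Z
    simp [mem_pi]
  rw [this, Measure.pi_pi]
  simp_rw [Measure.pi_pi]
  rw [Fintype.prod_prod_type]

theorem lintegral_pi_fin_succ {n : ℕ} {X : Type*} [MeasurableSpace X] (ν : Measure X) [SigmaFinite ν]
    {h : (Fin (n + 1) → X) → ℝ≥0∞} (hh : Measurable h) :
    ∫⁻ Z, h Z ∂(Measure.pi fun _ => ν)
      = ∫⁻ Y : Fin n → X, ∫⁻ y, h (Fin.cons y Y) ∂ν ∂(Measure.pi fun _ => ν) := by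
  have hmp := measurePreserving_piFinSuccAbove (fun _ : Fin (n + 1) => ν) 0
  rw [← hmp.symm.lintegral_comp_emb (MeasurableEquiv.measurableEmbedding _), lintegral_prod_symm]
  · refine lintegral_congr fun Y => lintegral_congr fun y => ?_
    simp [MeasurableEquiv.piFinSuccAbove, Fin.insertNthEquiv]
  · exact (hh.comp (MeasurableEquiv.measurable _)).aemeasurable

theorem lintegral_pi_fin_prod {X : Type*} [MeasurableSpace X] (ν : Measure X) [SigmaFinite ν] :
    ∀ {n : ℕ} {g : Fin n → X → ℝ≥0∞}, (∀ i, Measurable (g i)) →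
      ∫⁻ Z, ∏ i, g i (Z i) ∂(Measure.pi fun _ => ν) = ∏ i, ∫⁻ x, g i x ∂ν := by
  intro n
  induction n with
  | zero =>
    intro g _
    simp
  | succ n ih =>
    intro g hg
    rw [lintegral_pi_fin_succ ν (by fun_prop)]
    simp only [Fin.prod_univ_succ, Fin.cons_zero, Fin.cons_succ]
    have h1 : ∀ Y : Fin n → X, ∫⁻ y, g 0 y * ∏ i : Fin n, g i.succ (Y i) ∂ν
        = (∫⁻ y, g 0 y ∂ν) * ∏ i : Fin n, g i.succ (Y i) := fun Y => lintegral_mul_const _ (hg 0)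
    simp_rw [h1]
    rw [lintegral_const_mul _ (by fun_prop), ih fun i => hg i.succ]

theorem quasiMeasurePreserving_pi_fin {X β : Type*} [MeasurableSpace X] [MeasurableSpace β]
    {ν : Measure X} [SigmaFinite ν] {μ : Measure β} [SigmaFinite μ] {f : X → β}
    (hf : Measure.QuasiMeasurePreserving f ν μ) : ∀ n : ℕ,
      Measure.QuasiMeasurePreserving (fun (Y : Fin n → X) i => f (Y i))
        (Measure.pi fun _ => ν) (Measure.pi fun _ => μ) := by
  intro n
  induction n with
  | zero =>
    have : (fun (Y : Fin 0 → X) i => f (Y i)) = fun _ => isEmptyElim := by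
      ext Y i; exact i.elim0
    refine ⟨measurable_of_subsingleton_codomain _, ?_⟩
    rw [Measure.pi_of_empty, Measure.map_dirac' (measurable_of_subsingleton_codomain _),
      Measure.pi_of_empty]
    rw [Subsingleton.elim (fun i => f _)]
  | succ n ih =>
    have h1 := (measurePreserving_piFinSuccAbove (fun _ : Fin (n + 1) => ν) 0)
    have h2 := (measurePreserving_piFinSuccAbove (fun _ : Fin (n + 1) => μ) 0).symm
    have h3 := h2.quasiMeasurePreserving.comp ((QuasiMeasurePreserving.prodMap hf ih).comp h1.quasiMeasurePreserving)
    convert h3 using 1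
    ext Y i
    refine Fin.cases ?_ (fun j => ?_) i
    · rfl
    · rfl

theorem ae_det_ne_zero (n : ℕ) :
    ∀ᵐ Y : Fin n → Fin n → ℝ, (Matrix.of Y).det ≠ 0 := by
  have h := (measurePreserving_uncurry (ι := Fin n) (κ := Fin n)
    (volume : Measure ℝ)).quasiMeasurePreserving.ae
      (ae_eval_ne_zero (Matrix.det_mvPolynomialX_ne_zero (Fin n) ℝ))
  filter_upwards [h] with Y hY
  rwa [Matrix.eval_det_mvPolynomialX] at hY

/-! ### Minors of `n + 1` vectors in `ℝ^n` -/

/-- The absolute value of the determinant of the vectors `Z k`, `k ≠ i`. -/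
def absMinor {n : ℕ} (i : Fin (n + 1)) (Z : Fin (n + 1) → Fin n → ℝ) : ℝ :=
  |(Matrix.of fun k => Z (i.succAbove k)).det|

theorem absMinor_eq_abs_det {n : ℕ} (i : Fin (n + 1)) (Z : Fin (n + 1) → Fin n → ℝ) :
    absMinor i Z = |(Matrix.of fun k => (Fin.cons (if k = i then 1 else 0) (Z k) :
      Fin (n + 1) → ℝ)).det| := by
  rw [Matrix.det_succ_column_zero, Finset.sum_eq_single i]
  · simp only [Matrix.of_apply, Fin.cons_zero, if_true, mul_one, abs_mul, abs_pow, abs_neg, abs_one,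
      one_pow, one_mul]
    rfl
  · intro k _ hk
    simp [hk]
  · simp

theorem absMinor_comp_perm {n : ℕ} (i : Fin (n + 1)) (Z : Fin (n + 1) → Fin n → ℝ)
    (σ : Equiv.Perm (Fin (n + 1))) : absMinor i (fun k => Z (σ k)) = absMinor (σ i) Z := by
  rw [absMinor_eq_abs_det, absMinor_eq_abs_det]
  set B := (Matrix.of fun k => (Fin.cons (if k = σ i then 1 else 0) (Z k) : Fin (n + 1) → ℝ))
  have : (Matrix.of fun k => (Fin.cons (if k = i then 1 else 0) (Z (σ k)) : Fin (n + 1) → ℝ))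
      = B.submatrix σ id := by
    ext k c
    simp [B]
  rw [this, Matrix.det_permute, abs_mul]
  have hs : |((Equiv.Perm.sign σ : ℤ) : ℝ)| = 1 := by
    rcases Int.units_eq_one_or (Equiv.Perm.sign σ) with h | h <;> simp [h]
  rw [hs, one_mul]

theorem absMinor_zero_cons {n : ℕ} (v : Fin n → ℝ) (Y : Fin n → Fin n → ℝ) :
    absMinor 0 (Fin.cons v Y) = |(Matrix.of Y).det| := by
  simp [absMinor]

theorem absMinor_succ_cons {n : ℕ} (v : Fin n → ℝ) (Y : Fin n → Fin n → ℝ)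
    (hY : (Matrix.of Y).det ≠ 0) (j : Fin n) :
    absMinor j.succ (Fin.cons v Y)
      = |(((Matrix.of Y).transpose)⁻¹ *ᵥ v) j| * |(Matrix.of Y).det| := by
  have h1 := absMinor_comp_perm 0 (Fin.cons v Y : Fin (n + 1) → Fin n → ℝ) (Equiv.swap 0 j.succ)
  rw [Equiv.swap_apply_left] at h1
  rw [← h1, absMinor]
  have h2 : (Matrix.of fun k => (Fin.cons v Y : Fin (n + 1) → Fin n → ℝ)
      (Equiv.swap 0 j.succ ((0 : Fin (n + 1)).succAbove k))) = (Matrix.of Y).updateRow j v := by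
    ext k c
    rcases eq_or_ne k j with rfl | hk
    · simp
    · have := Equiv.swap_apply_of_ne_of_ne (Fin.succ_ne_zero k)
        (fun h => hk (Fin.succ_injective n h) : k.succ ≠ j.succ)
      simp [hk, this]
  rw [h2, ← Matrix.cramer_transpose_apply, Matrix.cramer_eq_adjugate_mulVec, ← abs_mul,
    Matrix.inv_def, Matrix.det_transpose, Ring.inverse_eq_inv', Matrix.smul_mulVec, Pi.smul_apply,
    smul_eq_mul]
  congr 1
  field_simp

theorem lintegral_prod_coord {n : ℕ} (Y : Fin n → Fin n → ℝ) (hY : (Matrix.of Y).det ≠ 0)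
    {ψ : Fin n → ℝ → ℝ≥0∞} (hψ : ∀ j, Measurable (ψ j)) :
    ∫⁻ v : Fin n → ℝ, ∏ j, ψ j ((((Matrix.of Y).transpose)⁻¹ *ᵥ v) j)
      = ENNReal.ofReal |(Matrix.of Y).det| * ∏ j, ∫⁻ t, ψ j t := by
  set A := ((Matrix.of Y).transpose)⁻¹ with hA
  have hdet : A.det = ((Matrix.of Y).det)⁻¹ := by
    rw [hA, Matrix.det_nonsing_inv, Matrix.det_transpose, Ring.inverse_eq_inv']
  have hA0 : A.det ≠ 0 := by rw [hdet]; exact inv_ne_zero hY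
  have h1 := Real.map_matrix_volume_pi_eq_smul_volume_pi hA0
  have h2 : Measurable (Matrix.toLin' A) :=
    (LinearMap.continuous_of_finiteDimensional _).measurable
  have h3 : ∫⁻ v : Fin n → ℝ, ∏ j, ψ j ((A *ᵥ v) j)
      = ∫⁻ v, ∏ j, ψ j (v j) ∂(Measure.map (Matrix.toLin' A) volume) := by
    rw [lintegral_map (by fun_prop) h2]
    simp
  rw [h3, h1, lintegral_smul_measure, hdet, inv_inv, smul_eq_mul]
  congr 1
  exact lintegral_pi_fin_prod volume hψ

/-! ### Symmetrization -/

theorem lintegral_comp_perm {n : ℕ} {X : Type*} [MeasurableSpace X] (ν : Measure X) [SigmaFinite ν]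
    (σ : Equiv.Perm (Fin n)) (h : (Fin n → X) → ℝ≥0∞) :
    ∫⁻ Z, h (fun k => Z (σ k)) ∂(Measure.pi fun _ => ν) = ∫⁻ Z, h Z ∂(Measure.pi fun _ => ν) := by
  have := (measurePreserving_piCongrLeft (fun _ : Fin n => ν) σ.symm)
  rw [← this.lintegral_comp_emb (MeasurableEquiv.measurableEmbedding _) h]
  refine lintegral_congr fun Z => ?_
  congr 1
  ext k
  simp [MeasurableEquiv.piCongrLeft, Equiv.piCongrLeft, Equiv.piCongrLeft']

theorem lintegral_le_of_symmetric {n : ℕ} {X : Type*} [MeasurableSpace X] (ν : Measure X)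
    [SigmaFinite ν] {V : Fin (n + 1) → (Fin (n + 1) → X) → ℝ}
    (hV : ∀ i, Measurable (V i))
    (hVσ : ∀ (i : Fin (n + 1)) (Z : Fin (n + 1) → X) (σ : Equiv.Perm (Fin (n + 1))),
      V i (fun k => Z (σ k)) = V (σ i) Z)
    {p : X → ℝ≥0∞} (hp : Measurable p) :
    ∫⁻ Z, ∏ i, p (Z i) ∂(Measure.pi fun _ : Fin (n + 1) => ν)
      ≤ (n + 1) * ∫⁻ Z, {Z | ∀ i, V i Z ≤ V 0 Z}.indicator (fun Z => ∏ i, p (Z i)) Z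
          ∂(Measure.pi fun _ : Fin (n + 1) => ν) := by
  set S : Fin (n + 1) → Set (Fin (n + 1) → X) := fun j => {Z | ∀ i, V i Z ≤ V j Z} with hS
  have hSm : ∀ j, MeasurableSet (S j) := by
    intro j
    have : S j = ⋂ i, {Z | V i Z ≤ V j Z} := by ext; simp [hS]
    rw [this]
    exact MeasurableSet.iInter fun i => measurableSet_le (hV i) (hV j)
  set P : (Fin (n + 1) → X) → ℝ≥0∞ := fun Z => ∏ i, p (Z i) with hP
  have hPm : Measurable P := by fun_prop
  have h1 : ∀ Z, P Z ≤ ∑ j, (S j).indicator P Z := by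
    intro Z
    obtain ⟨j, -, hj⟩ := Finset.exists_max_image Finset.univ (fun i => V i Z)
      ⟨0, Finset.mem_univ _⟩
    have hZ : Z ∈ S j := fun i => hj i (Finset.mem_univ _)
    calc P Z = (S j).indicator P Z := (indicator_of_mem hZ P).symm
      _ ≤ _ := Finset.single_le_sum (f := fun j => (S j).indicator P Z) (fun _ _ => zero_le)
        (Finset.mem_univ j)
  have h2 : ∀ j, ∫⁻ Z, (S j).indicator P Z ∂(Measure.pi fun _ : Fin (n + 1) => ν)
      = ∫⁻ Z, (S 0).indicator P Z ∂(Measure.pi fun _ : Fin (n + 1) => ν) := by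
    intro j
    rw [← lintegral_comp_perm ν (Equiv.swap 0 j) ((S 0).indicator P)]
    refine lintegral_congr fun Z => ?_
    have hmem : (fun k => Z (Equiv.swap 0 j k)) ∈ S 0 ↔ Z ∈ S j := by
      simp only [hS, mem_ofPred_eq, hVσ, Equiv.swap_apply_left]
      exact ⟨fun h i => by simpa using h (Equiv.swap 0 j i), fun h i => h _⟩
    have hPe : P (fun k => Z (Equiv.swap 0 j k)) = P Z :=
      Equiv.prod_comp (Equiv.swap 0 j) fun i => p (Z i)
    by_cases hZ : Z ∈ S j
    · rw [indicator_of_mem hZ, indicator_of_mem (hmem.2 hZ), hPe]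
    · rw [indicator_of_notMem hZ, indicator_of_notMem (fun h => hZ (hmem.1 h))]
  calc _ ≤ ∫⁻ Z, ∑ j, (S j).indicator P Z ∂(Measure.pi fun _ : Fin (n + 1) => ν) :=
        lintegral_mono h1
    _ = ∑ j, ∫⁻ Z, (S j).indicator P Z ∂(Measure.pi fun _ : Fin (n + 1) => ν) :=
        lintegral_finsetSum _ fun j _ => hPm.indicator (hSm j)
    _ = ∑ _j : Fin (n + 1), ∫⁻ Z, (S 0).indicator P Z ∂(Measure.pi fun _ : Fin (n + 1) => ν) :=
        Finset.sum_congr rfl fun j _ => h2 j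
    _ = _ := by simp [hS, hP]

/-- The one-dimensional majorant `t^(-1/n) / max a t`. -/
noncomputable def radialKernel (n : ℕ) (a t : ℝ) : ℝ≥0∞ :=
  ENNReal.ofReal t ^ (-(1 / n : ℝ)) * (ENNReal.ofReal (max a t))⁻¹

noncomputable def radialConst (n : ℕ) : ℝ≥0∞ := ∫⁻ t : ℝ, radialKernel n 1 |t|

@[fun_prop]
theorem measurable_radialKernel (n : ℕ) (a : ℝ) : Measurable (radialKernel n a) := by
  unfold radialKernel
  fun_prop

theorem radialConst_lt_top {n : ℕ} (hn : 2 ≤ n) : radialConst n < ∞ := by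
  have hn' : (2 : ℝ) ≤ n := by exact_mod_cast hn
  have hn1 : (1 / n : ℝ) < 1 := by rw [div_lt_one] <;> linarith
  have hn0 : (0 : ℝ) < 1 / n := by positivity
  have hmeas : Measurable fun t : ℝ => radialKernel n 1 |t| := by fun_prop
  have hneg : ∫⁻ t in Iio (0 : ℝ), radialKernel n 1 |t| = ∫⁻ t in Ioi (0 : ℝ), radialKernel n 1 |t| := by
    have := (Measure.measurePreserving_neg (volume : Measure ℝ)).setLIntegral_comp_preimage
      (measurableSet_Ioi (a := (0 : ℝ))) hmeas
    simpa using this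
  have h1 : ∫⁻ t in Ioc (0 : ℝ) 1, radialKernel n 1 |t| < ∞ := by
    have hi : IntegrableOn (fun t : ℝ => t ^ (-(1 / n : ℝ))) (Ioc 0 1) :=
      (intervalIntegrable_iff_integrableOn_Ioc_of_le zero_le_one).1
        (intervalIntegral.intervalIntegrable_rpow' (by linarith))
    refine lt_of_le_of_lt ?_ hi.lintegral_lt_top
    refine setLIntegral_mono' measurableSet_Ioc fun t ht => ?_
    rw [radialKernel, abs_of_pos ht.1, max_eq_left ht.2, ENNReal.ofReal_rpow_of_pos ht.1]
    simp
  have h2 : ∫⁻ t in Ioi (1 : ℝ), radialKernel n 1 |t| < ∞ := by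
    have hi : IntegrableOn (fun t : ℝ => t ^ (-(1 / n : ℝ) - 1)) (Ioi 1) :=
      integrableOn_Ioi_rpow_of_lt (by linarith) one_pos
    refine lt_of_le_of_lt ?_ hi.lintegral_lt_top
    refine setLIntegral_mono' measurableSet_Ioi fun t ht => ?_
    have ht0 : 0 < t := one_pos.trans ht
    rw [radialKernel, abs_of_pos ht0, max_eq_right (le_of_lt ht), ENNReal.ofReal_rpow_of_pos ht0,
      ← ENNReal.ofReal_inv_of_pos ht0, ← ENNReal.ofReal_mul (by positivity),
      Real.rpow_sub_one ht0.ne', div_eq_mul_inv (t ^ _)]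
  have h3 : ∫⁻ t in Ioi (0 : ℝ), radialKernel n 1 |t| < ∞ := by
    rw [← Ioc_union_Ioi_eq_Ioi zero_le_one]
    exact (lintegral_union_le _ _ _).trans_lt (ENNReal.add_lt_top.2 ⟨h1, h2⟩)
  have h4 : ∫⁻ t in Ici (0 : ℝ), radialKernel n 1 |t| < ∞ := by
    rwa [← setLIntegral_congr Ioi_ae_eq_Ici]
  rw [radialConst, ← setLIntegral_univ, ← Iio_union_Ici (a := (0 : ℝ))]
  exact (lintegral_union_le _ _ _).trans_lt (ENNReal.add_lt_top.2 ⟨hneg ▸ h3, h4⟩)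

theorem lintegral_radialKernel (n : ℕ) {a u : ℝ} (ha : 0 < a) (hu : 0 < u) :
    ∫⁻ t : ℝ, radialKernel n a (|t| * u)
      = (ENNReal.ofReal u)⁻¹ * ENNReal.ofReal a ^ (-(1 / n : ℝ)) * radialConst n := by
  have hua : u / a ≠ 0 := (div_pos hu ha).ne'
  have ha0 : ENNReal.ofReal a ≠ 0 := by simpa using ha
  have h1 : ∀ t : ℝ, radialKernel n a (|t| * u) = ENNReal.ofReal a ^ (-(1 / n : ℝ)) *
      (ENNReal.ofReal a)⁻¹ * radialKernel n 1 |u / a * t| := by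
    intro t
    have e1 : |t| * u = a * |u / a * t| := by
      rw [abs_mul, abs_of_pos (div_pos hu ha)]
      field_simp
    rw [e1]
    set s := |u / a * t|
    have e2 : max a (a * s) = a * max 1 s := by
      rw [mul_max_of_nonneg _ _ ha.le, mul_one]
    rw [radialKernel, radialKernel, e2, ENNReal.ofReal_mul ha.le, ENNReal.ofReal_mul ha.le,
      ENNReal.mul_rpow_of_ne_top ENNReal.ofReal_ne_top ENNReal.ofReal_ne_top,
      ENNReal.mul_inv (Or.inl ha0) (Or.inl ENNReal.ofReal_ne_top)]
    ring
  have hmeas : Measurable fun t : ℝ => radialKernel n 1 |t| := by fun_prop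
  simp_rw [h1]
  rw [lintegral_const_mul _ (by fun_prop)]
  have h2 : ∫⁻ t : ℝ, radialKernel n 1 |u / a * t| = ENNReal.ofReal (a / u) * radialConst n := by
    rw [← lintegral_map (f := fun t : ℝ => radialKernel n 1 |t|) hmeas (by fun_prop),
      Real.map_volume_mul_left hua, lintegral_smul_measure, inv_div,
      abs_of_pos (div_pos ha hu)]
    rfl
  rw [h2, ENNReal.ofReal_div_of_pos hu, div_eq_mul_inv (ENNReal.ofReal a)]
  calc _ = ((ENNReal.ofReal a)⁻¹ * ENNReal.ofReal a) * ((ENNReal.ofReal u)⁻¹ *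
        ENNReal.ofReal a ^ (-(1 / n : ℝ)) * radialConst n) := by ring
    _ = _ := by rw [ENNReal.inv_mul_cancel ha0 ENNReal.ofReal_ne_top, one_mul]

theorem ofReal_mul_le_prod_radialKernel {n : ℕ} (hn : n ≠ 0) {a w F : ℝ} (ha : 0 < a) (haw : a ≤ w)
    (hF : 1 ≤ F) {t : Fin n → ℝ} (ht : ∀ j, t j ≤ w / F) :
    ENNReal.ofReal (F * w) ≤ ENNReal.ofReal w ^ (n + 2) * ∏ j, radialKernel n a (t j) := by
  have hw : 0 < w := ha.trans_le haw
  have hF0 : 0 < F := one_pos.trans_le hF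
  have hn' : (n : ℝ) ≠ 0 := by exact_mod_cast hn
  have hw0 : ENNReal.ofReal w ≠ 0 := by simpa using hw
  have h1 : ∀ j, ENNReal.ofReal (w / F) ^ (-(1 / n : ℝ)) * (ENNReal.ofReal w)⁻¹
      ≤ radialKernel n a (t j) := by
    intro j
    rw [radialKernel]
    gcongr ?_ * ?_
    · rw [ENNReal.rpow_neg, ENNReal.rpow_neg]
      have := ht j
      gcongr
    · have : t j ≤ w := (ht j).trans (div_le_self hw.le hF)
      gcongr
      exact max_le haw this
  calc ENNReal.ofReal (F * w)
      = ENNReal.ofReal w ^ (n + 2) *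
          ∏ _j : Fin n, (ENNReal.ofReal (w / F) ^ (-(1 / n : ℝ)) * (ENNReal.ofReal w)⁻¹) := by
        rw [Finset.prod_const, Finset.card_univ, Fintype.card_fin, mul_pow,
          ← ENNReal.rpow_natCast (_ ^ (-(1 / n : ℝ))), ← ENNReal.rpow_mul, neg_mul, one_div, inv_mul_cancel₀ hn', ENNReal.rpow_neg_one,
          ENNReal.ofReal_div_of_pos hF0, ENNReal.inv_div (Or.inl ENNReal.ofReal_ne_top)
            (Or.inl (by simpa using hF0)), ENNReal.ofReal_mul hF0.le, pow_add, div_eq_mul_inv,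
          ← ENNReal.inv_pow]
        have e1 : ENNReal.ofReal w ^ n * (ENNReal.ofReal w ^ n)⁻¹ = 1 :=
          ENNReal.mul_inv_cancel (pow_ne_zero _ hw0) (ENNReal.pow_ne_top ENNReal.ofReal_ne_top)
        have e2 : ENNReal.ofReal w * (ENNReal.ofReal w)⁻¹ = 1 :=
          ENNReal.mul_inv_cancel hw0 ENNReal.ofReal_ne_top
        calc _ = ENNReal.ofReal F * ENNReal.ofReal w * (ENNReal.ofReal w ^ n * (ENNReal.ofReal w ^ n)⁻¹)
              * (ENNReal.ofReal w * (ENNReal.ofReal w)⁻¹) := by rw [e1, e2]; ring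
          _ = _ := by ring
    _ ≤ _ := by
        gcongr with j
        exact h1 j

/-- The multilinear determinant inequality: if the map `f : X → ℝ^n` carries `w^(n+2) ν` to a measure of
density at most `l`, and `w ≥ a`, then the integral of `F² ⊗ ⋯ ⊗ F² · |det(f(y₁), …, f(y_n))|`
controls the `(n+1)`-st power of the integral of `F w`. -/
theorem lintegral_pow_le_lintegral_det {n : ℕ} (hn : n ≠ 0) {X : Type*} [MeasurableSpace X]
    (ν : Measure X) [SigmaFinite ν] {f : X → Fin n → ℝ} (hf : Measurable f) {w F : X → ℝ}
    (hwm : Measurable w) (hFm : Measurable F) {a : ℝ} (ha : 0 < a) (hw : ∀ y, a ≤ w y)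
    (hF : ∀ y, 1 ≤ F y) {l : ℝ≥0∞}
    (hl : ∀ g : (Fin n → ℝ) → ℝ≥0∞, Measurable g →
      ∫⁻ y, ENNReal.ofReal (w y) ^ (n + 2) * g (f y) ∂ν ≤ l * ∫⁻ v, g v) :
    (∫⁻ y, ENNReal.ofReal (F y * w y) ∂ν) ^ (n + 1) ≤
      (n + 1) * l * radialConst n ^ n * (ENNReal.ofReal a)⁻¹ *
        ∫⁻ Y : Fin n → X, (∏ j, ENNReal.ofReal (F (Y j)) ^ 2) *
          ENNReal.ofReal |(Matrix.of fun j => f (Y j)).det| ∂(Measure.pi fun _ => ν) := by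
  have hw0 : ∀ y, 0 < w y := fun y => ha.trans_le (hw y)
  have hF0 : ∀ y, 0 < F y := fun y => one_pos.trans_le (hF y)
  have hn' : (n : ℝ) ≠ 0 := by exact_mod_cast hn
  set u : X → ℝ := fun y => w y / F y with hu
  have hu0 : ∀ y, 0 < u y := fun y => div_pos (hw0 y) (hF0 y)
  have hum : Measurable u := hwm.div hFm
  set p : X → ℝ≥0∞ := fun y => ENNReal.ofReal (F y * w y) with hp
  have hpm : Measurable p := by fun_prop
  have hdetm : Measurable fun Y : Fin n → Fin n → ℝ => (Matrix.of Y).det := by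
    apply Continuous.measurable
    exact Continuous.matrix_det (by fun_prop)
  let V : Fin (n + 1) → (Fin (n + 1) → X) → ℝ := fun i Z =>
    absMinor i (fun k => f (Z k)) * u (Z i)
  have hV : ∀ i, Measurable (V i) := by
    intro i
    have h1 : Measurable fun Z : Fin (n + 1) → X => fun k => f (Z (i.succAbove k)) := by fun_prop
    exact (hdetm.comp h1).abs.mul (by fun_prop)
  have hVσ : ∀ (i : Fin (n + 1)) (Z : Fin (n + 1) → X) (σ : Equiv.Perm (Fin (n + 1))),
      V i (fun k => Z (σ k)) = V (σ i) Z := by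
    intro i Z σ
    simp only [V]
    rw [absMinor_comp_perm i (fun k => f (Z k)) σ]
  have hqmp : Measure.QuasiMeasurePreserving f ν volume := by
    refine ⟨hf, Measure.AbsolutelyContinuous.mk fun s hs h0 => ?_⟩
    rw [Measure.map_apply hf hs]
    have h1 := hl (s.indicator 1) (measurable_one.indicator hs)
    rw [lintegral_indicator_one hs, h0, mul_zero, nonpos_iff_eq_zero, lintegral_eq_zero_iff
      (by fun_prop (disch := assumption))] at h1
    have h2 : ∀ᵐ y ∂ν, y ∉ f ⁻¹' s := by
      filter_upwards [h1] with y hy hys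
      have : f y ∈ s := hys
      have h3 := hw0 y
      simp [this] at hy
      linarith
    exact measure_eq_zero_iff_ae_notMem.2 h2
  have hdet : ∀ᵐ Y : Fin n → X ∂(Measure.pi fun _ => ν),
      (Matrix.of fun j => f (Y j)).det ≠ 0 :=
    (quasiMeasurePreserving_pi_fin hqmp n).ae (ae_det_ne_zero n)
  have hind : Measurable ({Z | ∀ i, V i Z ≤ V 0 Z}.indicator
      (fun Z : Fin (n + 1) → X => ∏ i, p (Z i))) := by
    refine Measurable.indicator (by fun_prop) ?_
    have : {Z | ∀ i, V i Z ≤ V 0 Z} = ⋂ i, {Z | V i Z ≤ V 0 Z} := by ext; simp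
    rw [this]
    exact MeasurableSet.iInter fun i => measurableSet_le (hV i) (hV 0)
  have hinner : ∀ Y : Fin n → X, (Matrix.of fun j => f (Y j)).det ≠ 0 →
      ∫⁻ y, {Z | ∀ i, V i Z ≤ V 0 Z}.indicator (fun Z => ∏ i, p (Z i))
        (Fin.cons y Y : Fin (n + 1) → X) ∂ν
      ≤ l * radialConst n ^ n * (ENNReal.ofReal a)⁻¹ * ((∏ j, ENNReal.ofReal (F (Y j)) ^ 2) *
          ENNReal.ofReal |(Matrix.of fun j => f (Y j)).det|) := by
    intro Y hY
    set D := (Matrix.of fun j => f (Y j)).det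
    let c : (Fin n → ℝ) → Fin n → ℝ := fun v =>
      ((Matrix.of fun j => f (Y j)).transpose)⁻¹ *ᵥ v
    have hcm : Measurable c := by
      apply Continuous.measurable
      exact Continuous.matrix_mulVec continuous_const continuous_id
    have hpt : ∀ y, {Z | ∀ i, V i Z ≤ V 0 Z}.indicator (fun Z => ∏ i, p (Z i))
        (Fin.cons y Y : Fin (n + 1) → X)
        ≤ (∏ j, p (Y j)) * (ENNReal.ofReal (w y) ^ (n + 2) *
          ∏ j, radialKernel n a (|c (f y) j| * u (Y j))) := by
      intro y
      rw [indicator_apply]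
      split_ifs with hZ
      swap
      · exact zero_le
      rw [Fin.prod_univ_succ, mul_comm]
      simp only [Fin.cons_zero, Fin.cons_succ]
      gcongr
      refine ofReal_mul_le_prod_radialKernel hn ha (hw y) (hF y) fun j => ?_
      have h1 : V j.succ (Fin.cons y Y) ≤ V 0 (Fin.cons y Y) := hZ j.succ
      have h2 : (fun k => f ((Fin.cons y Y : Fin (n + 1) → X) k))
          = Fin.cons (f y) fun j => f (Y j) := by
        ext k : 1
        refine Fin.cases rfl (fun k => rfl) k
      simp only [V, h2, Fin.cons_zero, Fin.cons_succ] at h1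
      rw [absMinor_zero_cons, absMinor_succ_cons _ _ hY] at h1
      have hD : 0 < |D| := abs_pos.2 hY
      have h3 : |D| * (|c (f y) j| * u (Y j)) ≤ |D| * u y := by
        calc _ = |c (f y) j| * |D| * u (Y j) := by ring
          _ ≤ _ := h1
      exact le_of_mul_le_mul_left h3 hD
    have hfac : ∀ j, p (Y j) * ((ENNReal.ofReal (u (Y j)))⁻¹ *
        ENNReal.ofReal a ^ (-(1 / n : ℝ)) * radialConst n)
        = ENNReal.ofReal (F (Y j)) ^ 2 * (ENNReal.ofReal a ^ (-(1 / n : ℝ)) * radialConst n) := by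
      intro j
      have : p (Y j) * (ENNReal.ofReal (u (Y j)))⁻¹ = ENNReal.ofReal (F (Y j)) ^ 2 := by
        rw [hp, ← ENNReal.ofReal_inv_of_pos (hu0 _),
          ← ENNReal.ofReal_mul (mul_pos (hF0 _) (hw0 _)).le, ← ENNReal.ofReal_pow (hF0 _).le]
        congr 1
        have := (hF0 (Y j)).ne'
        have := (hw0 (Y j)).ne'
        simp only [hu]
        field_simp
      rw [← this]
      ring
    calc _ ≤ ∫⁻ y, (∏ j, p (Y j)) * (ENNReal.ofReal (w y) ^ (n + 2) *
          ∏ j, radialKernel n a (|c (f y) j| * u (Y j))) ∂ν := lintegral_mono hpt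
      _ = (∏ j, p (Y j)) * ∫⁻ y, (ENNReal.ofReal (w y) ^ (n + 2) *
          ∏ j, radialKernel n a (|c (f y) j| * u (Y j))) ∂ν :=
          lintegral_const_mul _ (by fun_prop)
      _ ≤ (∏ j, p (Y j)) * (l * ∫⁻ v, ∏ j, radialKernel n a (|c v j| * u (Y j))) := by
          gcongr
          exact hl (fun v => ∏ j, radialKernel n a (|c v j| * u (Y j))) (by fun_prop)
      _ = (∏ j, p (Y j)) * (l * (ENNReal.ofReal |D| * ∏ j, ((ENNReal.ofReal (u (Y j)))⁻¹ *
            ENNReal.ofReal a ^ (-(1 / n : ℝ)) * radialConst n))) := by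
          rw [lintegral_prod_coord (fun j => f (Y j)) hY
            (ψ := fun j t => radialKernel n a (|t| * u (Y j))) (fun j => by fun_prop)]
          simp_rw [lintegral_radialKernel n ha (hu0 _)]
          rfl
      _ = l * ENNReal.ofReal |D| * ∏ j, (p (Y j) * ((ENNReal.ofReal (u (Y j)))⁻¹ *
            ENNReal.ofReal a ^ (-(1 / n : ℝ)) * radialConst n)) := by
          rw [Finset.prod_mul_distrib (f := fun j => p (Y j))]
          ring
      _ = _ := by
          simp_rw [hfac]
          rw [Finset.prod_mul_distrib, Finset.prod_const, Finset.card_univ, Fintype.card_fin,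
            mul_pow, ← ENNReal.rpow_natCast (ENNReal.ofReal a ^ _), ← ENNReal.rpow_mul, neg_mul,
            one_div, inv_mul_cancel₀ hn', ENNReal.rpow_neg_one]
          ring
  calc (∫⁻ y, p y ∂ν) ^ (n + 1)
      = ∫⁻ Z, ∏ i, p (Z i) ∂(Measure.pi fun _ : Fin (n + 1) => ν) := by
        rw [lintegral_pi_fin_prod ν (g := fun _ => p) fun _ => hpm]
        simp
    _ ≤ (n + 1) * ∫⁻ Z, {Z | ∀ i, V i Z ≤ V 0 Z}.indicator (fun Z => ∏ i, p (Z i)) Z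
          ∂(Measure.pi fun _ : Fin (n + 1) => ν) := lintegral_le_of_symmetric ν hV hVσ hpm
    _ ≤ (n + 1) * ∫⁻ Y : Fin n → X, l * radialConst n ^ n * (ENNReal.ofReal a)⁻¹ *
          ((∏ j, ENNReal.ofReal (F (Y j)) ^ 2) *
          ENNReal.ofReal |(Matrix.of fun j => f (Y j)).det|) ∂(Measure.pi fun _ => ν) := by
        rw [lintegral_pi_fin_succ ν hind]
        gcongr 1
        refine lintegral_mono_ae ?_
        filter_upwards [hdet] with Y hY using hinner Y hY
    _ = _ := by
        have h1 : Measurable fun Y : Fin n → X => fun j => f (Y j) := by fun_prop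
        have h2 : Measurable fun Y : Fin n → X => (Matrix.of fun j => f (Y j)).det :=
          hdetm.comp h1
        rw [lintegral_const_mul _ (by fun_prop)]
        ring

/-! ### Gradients and graphs -/

theorem gradient_apply {n : ℕ} (φ : Euc n → ℝ) (x : Euc n) (i : Fin n) :
    gradient φ x i = fderiv ℝ φ x (EuclideanSpace.single i 1) := by
  have h : inner ℝ (gradient φ x) (EuclideanSpace.single i (1 : ℝ))
      = fderiv ℝ φ x (EuclideanSpace.single i 1) := by
    rw [← toDual_gradient, InnerProductSpace.toDual_apply_apply]
  rw [← h, EuclideanSpace.inner_single_right]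
  simp

@[fun_prop]
theorem measurable_gradient {n : ℕ} (φ : Euc n → ℝ) : Measurable (gradient φ) := by
  have h : gradient φ = fun x => (InnerProductSpace.toDual ℝ (Euc n)).symm (fderiv ℝ φ x) := rfl
  rw [h]
  exact (LinearIsometryEquiv.continuous _).measurable.comp (measurable_fderiv ℝ φ)

@[fun_prop]
theorem measurable_hessianDet {n : ℕ} (φ : Euc n → ℝ) : Measurable (hessianDet φ) :=
  ContinuousLinearMap.continuous_det.measurable.comp (measurable_fderiv ℝ (gradient φ))

theorem hasStrictFDerivAt_gradient {n : ℕ} {φ : Euc n → ℝ} {x : Euc n} (h : ContDiffAt ℝ 2 φ x) :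
    HasStrictFDerivAt (gradient φ) (fderiv ℝ (gradient φ) x) x := by
  have h1 : ContDiffAt ℝ 1 (fderiv ℝ φ) x := h.fderiv_right (by norm_num)
  have h2 : ContDiffAt ℝ 1 (gradient φ) x :=
    (InnerProductSpace.toDual ℝ (Euc n)).symm.toContinuousLinearEquiv.contDiff.contDiffAt.comp x h1
  exact h2.hasStrictFDerivAt (by norm_num)

/-- The point of `ℝ^(n+1)` with horizontal part `z` and last coordinate `t`. -/
def snocEuc {n : ℕ} (p : Euc n × ℝ) : Euc (n + 1) :=
  WithLp.toLp 2 (Fin.snoc (α := fun _ => ℝ) (fun i => p.1 i) p.2)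

theorem measurePreserving_snocEuc (n : ℕ) :
    MeasurePreserving (snocEuc : Euc n × ℝ → Euc (n + 1)) := by
  have h1 : MeasurePreserving (fun p : Euc n × ℝ => (p.2, (WithLp.ofLp p.1 : Fin n → ℝ))) :=
    ((MeasurePreserving.id volume).prod (PiLp.volume_preserving_ofLp (Fin n))).comp
      Measure.measurePreserving_swap
  have h2 := (volume_preserving_piFinSuccAbove (fun _ : Fin (n + 1) => ℝ) (Fin.last n)).symm
  have h3 := (PiLp.volume_preserving_toLp (Fin (n + 1))).comp (h2.comp h1)
  convert h3 using 1
  ext p i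
  simp [snocEuc, MeasurableEquiv.piFinSuccAbove, Fin.insertNthEquiv, Fin.insertNth_last']

theorem snocEuc_graph {n : ℕ} (φ : Euc n → ℝ) (x : Euc n) : graphMap φ x = snocEuc (x, φ x) := rfl

theorem snocEuc_sub {n : ℕ} (p q : Euc n × ℝ) : snocEuc p - snocEuc q = snocEuc (p - q) := by
  ext i
  refine Fin.lastCases ?_ (fun i => ?_) i <;> simp [snocEuc]

theorem measurable_graphMap {n : ℕ} {φ : Euc n → ℝ} (hφ : Measurable φ) :
    Measurable (graphMap φ) :=
  (measurePreserving_snocEuc n).measurable.comp (measurable_id.prodMk hφ)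

theorem measurePreserving_pi_snocEuc (n : ℕ) :
    MeasurePreserving (fun (p : (Fin n → Euc n) × Euc n) (j : Fin n) =>
      snocEuc (p.1 j, p.2 j)) := by
  have h1 : MeasurePreserving (fun p : (Fin n → Euc n) × Euc n =>
      (p.1, (WithLp.ofLp p.2 : Fin n → ℝ))) :=
    (MeasurePreserving.id volume).prod (PiLp.volume_preserving_ofLp (Fin n))
  have h2 := (volume_measurePreserving_arrowProdEquivProdArrow (Euc n) ℝ (Fin n)).symm
  have h3 := volume_preserving_pi (fun _ : Fin n => measurePreserving_snocEuc n)
  exact h3.comp (h2.comp h1)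

theorem abs_det_sub_comm {n : ℕ} (A B : Fin n → Fin n → ℝ) :
    |(Matrix.of fun j i => A j i - B j i).det| = |(Matrix.of fun j i => B j i - A j i).det| := by
  have : (Matrix.of fun j i => A j i - B j i) = -(Matrix.of fun j i => B j i - A j i) := by
    ext j i; simp
  rw [this, Matrix.det_neg, abs_mul]
  simp

/-- The derivative in `x` of `(φ x - φ (x - Z j))_j`. -/
noncomputable def diffDeriv {n : ℕ} (φ : Euc n → ℝ) (Z : Fin n → Euc n) (x : Euc n) :
    Euc n →L[ℝ] Euc n :=
  (EuclideanSpace.equiv (Fin n) ℝ).symm.toContinuousLinearMap ∘L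
    ContinuousLinearMap.pi fun j => fderiv ℝ φ x - fderiv ℝ φ (x - Z j)

theorem det_diffDeriv {n : ℕ} (φ : Euc n → ℝ) (Z : Fin n → Euc n) (x : Euc n) :
    (diffDeriv φ Z x).det
      = (Matrix.of fun j i => gradient φ x i - gradient φ (x - Z j) i).det := by
  rw [ContinuousLinearMap.det, ← LinearMap.det_toMatrix (EuclideanSpace.basisFun (Fin n) ℝ).toBasis]
  congr 1
  ext j i
  simp [diffDeriv, LinearMap.toMatrix_apply, gradient_apply, EuclideanSpace.equiv]

theorem hasStrictFDerivAt_diff {n : ℕ} {φ : Euc n → ℝ} {Ω : Set (Euc n)} (hΩ : IsOpen Ω)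
    (hφ : ContDiffOn ℝ 2 φ Ω) {Z : Fin n → Euc n} {x : Euc n} (hx : x ∈ Ω)
    (hxZ : ∀ j, x - Z j ∈ Ω) :
    HasStrictFDerivAt (fun x => (WithLp.toLp 2 fun j => φ x - φ (x - Z j) : Euc n))
      (diffDeriv φ Z x) x := by
  have hd : ∀ {y}, y ∈ Ω → HasStrictFDerivAt φ (fderiv ℝ φ y) y := fun hy =>
    (hφ.contDiffAt (hΩ.mem_nhds hy)).hasStrictFDerivAt (by norm_num)
  have h1 : HasStrictFDerivAt (fun x => fun j => φ x - φ (x - Z j))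
      (ContinuousLinearMap.pi fun j => fderiv ℝ φ x - fderiv ℝ φ (x - Z j)) x := by
    refine hasStrictFDerivAt_pi'.2 fun j => ?_
    refine (hd hx).sub ?_
    have h2 : HasStrictFDerivAt (fun x : Euc n => x - Z j) (ContinuousLinearMap.id ℝ (Euc n)) x :=
      (hasStrictFDerivAt_id x).sub_const (Z j)
    exact (hd (hxZ j)).comp x h2
  exact (EuclideanSpace.equiv (Fin n) ℝ).symm.toContinuousLinearMap.hasStrictFDerivAt.comp x h1

theorem encard_diff_fiber_le {n : ℕ} (φ : Euc n → ℝ) (Ω : Set (Euc n)) (Z : Fin n → Euc n)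
    (u : Euc n) :
    ({x | x ∈ Ω ∧ ∀ j, x - Z j ∈ Ω} ∩
      (fun x => (WithLp.toLp 2 fun j => φ x - φ (x - Z j) : Euc n)) ⁻¹' {u}).encard
    ≤ (powSet Ω ∩ diffMap φ ⁻¹' {fun j => snocEuc (Z j, u j)}).encard := by
  refine encard_le_encard_of_injOn (f := fun x => (Fin.cons x fun j => x - Z j)) ?_ ?_
  · rintro x ⟨⟨hx, hxZ⟩, hxu⟩
    refine ⟨fun i => ?_, ?_⟩
    · refine Fin.cases hx (fun j => hxZ j) i
    · ext1 j
      have : φ x - φ (x - Z j) = u j := by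
        rw [← show (WithLp.toLp 2 fun j => φ x - φ (x - Z j) : Euc n) = u from hxu]
      simp [diffMap, snocEuc_graph, snocEuc_sub, this]
  · intro x _ y _ hxy
    simpa using congrFun hxy 0

/-- The change of variables `Ψ`. -/
theorem lintegral_prod_diff_mul_det_le {n : ℕ} {φ : Euc n → ℝ} {Ω : Set (Euc n)} (hΩ : IsOpen Ω)
    (hφ : ContDiffOn ℝ 2 φ Ω) (hφm : Measurable φ) {m : ℕ}
    (hm : GenericMultiplicityLE (diffMap φ) (powSet Ω) m) {g : Euc (n + 1) → ℝ≥0∞}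
    (hg : Measurable g) :
    ∫⁻ x in Ω, ∫⁻ Y : Fin n → Euc n, (∏ j, g (graphMap φ x - graphMap φ (Y j))) *
        ENNReal.ofReal |(Matrix.of fun j i => gradient φ (Y j) i - gradient φ x i).det|
        ∂(Measure.pi fun _ => volume.restrict Ω)
      ≤ m * (∫⁻ y, g y) ^ n := by
  have hΩm := hΩ.measurableSet
  have hγ := measurable_graphMap hφm
  have hdetm : Measurable fun Y : Fin n → Fin n → ℝ => (Matrix.of Y).det := by
    apply Continuous.measurable
    exact Continuous.matrix_det (by fun_prop)
  set G : Euc n → (Fin n → Euc n) → ℝ≥0∞ := fun x Y =>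
    (∏ j, g (graphMap φ x - graphMap φ (Y j))) *
        ENNReal.ofReal |(Matrix.of fun j i => gradient φ (Y j) i - gradient φ x i).det| with hG
  have hGm : Measurable (Function.uncurry G) := by
    have h1 : Measurable fun p : Euc n × (Fin n → Euc n) =>
        (Matrix.of fun j i => gradient φ (p.2 j) i - gradient φ p.1 i).det :=
      hdetm.comp (by fun_prop)
    have h2 : ∀ j, Measurable fun p : Euc n × (Fin n → Euc n) =>
        g (graphMap φ p.1 - graphMap φ (p.2 j)) := fun j => by fun_prop
    simp only [hG, Function.uncurry_def]
    fun_prop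
  set S : Set (Euc n × (Fin n → Euc n)) := {p | p.1 ∈ Ω ∧ ∀ j, p.2 j ∈ Ω} with hS
  have hSm : MeasurableSet S := by
    have : S = Prod.fst ⁻¹' Ω ∩ ⋂ j, (fun p : Euc n × (Fin n → Euc n) => p.2 j) ⁻¹' Ω := by ext; simp [hS]
    rw [this]
    exact (measurable_fst hΩm).inter (MeasurableSet.iInter fun j =>
      (show Measurable fun p : Euc n × (Fin n → Euc n) => p.2 j by fun_prop) hΩm)
  set I : Euc n × (Fin n → Euc n) → ℝ≥0∞ := S.indicator (Function.uncurry G) with hI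
  have hIm : Measurable I := hGm.indicator hSm
  have hLHS : ∫⁻ x in Ω, ∫⁻ Y, G x Y ∂(Measure.pi fun _ => volume.restrict Ω)
      = ∫⁻ x, ∫⁻ Y, I (x, Y) := by
    rw [← lintegral_indicator hΩm]
    refine lintegral_congr fun x => ?_
    have h1 : (Measure.pi fun _ : Fin n => (volume : Measure (Euc n)).restrict Ω)
        = (volume : Measure (Fin n → Euc n)).restrict (univ.pi fun _ => Ω) := by
      rw [volume_pi, Measure.restrict_pi_pi]
    rw [h1]
    by_cases hx : x ∈ Ω
    · rw [indicator_of_mem hx, ← lintegral_indicator (MeasurableSet.univ_pi fun _ => hΩm)]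
      refine lintegral_congr fun Y => ?_
      have hiff : (x, Y) ∈ S ↔ Y ∈ univ.pi fun _ : Fin n => Ω := by simp [hS, hx]
      by_cases hY : Y ∈ univ.pi fun _ : Fin n => Ω
      · rw [indicator_of_mem hY, hI, indicator_of_mem (hiff.2 hY)]
        rfl
      · rw [indicator_of_notMem hY, hI, indicator_of_notMem fun h => hY (hiff.1 h)]
    · simp [hI, hS, hx]
  have : (volume : Measure (Fin n → Euc n)).IsNegInvariant := Measure.pi.isNegInvariant _
  have hshift : ∀ x, ∫⁻ Y, I (x, Y) = ∫⁻ Z : Fin n → Euc n, I (x, fun j => x - Z j) := fun x =>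
    (lintegral_sub_left_eq_self (μ := (volume : Measure (Fin n → Euc n)))
      (fun Y => I (x, Y)) fun _ => x).symm
  set K : (Fin n → Euc n) → Euc n → ℝ≥0∞ := fun Z u => ∏ j, g (snocEuc (Z j, u j)) with hK
  have hKm : Measurable (Function.uncurry K) := by
    have h1 : Measurable fun p : (Fin n → Euc n) × Euc n => ∏ j, g (snocEuc (p.1 j, p.2 j)) := by
      have h2 : ∀ j, Measurable fun p : (Fin n → Euc n) × Euc n => snocEuc (p.1 j, p.2 j) :=
        fun j => (measurePreserving_snocEuc n).measurable.comp (by fun_prop)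
      fun_prop
    exact h1
  have hmult : ∀ᵐ Z : Fin n → Euc n, ∀ᵐ u : Euc n, ({x | x ∈ Ω ∧ ∀ j, x - Z j ∈ Ω} ∩
      (fun x => (WithLp.toLp 2 fun j => φ x - φ (x - Z j) : Euc n)) ⁻¹' {u}).encard ≤ (m : ℕ∞) := by
    have h1 := (measurePreserving_pi_snocEuc n).quasiMeasurePreserving.ae hm
    rw [Measure.volume_eq_prod] at h1
    filter_upwards [Measure.ae_ae_of_ae_prod h1] with Z hZ
    filter_upwards [hZ] with u hu
    exact (encard_diff_fiber_le φ Ω Z u).trans hu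
  have hpt : ∀ᵐ Z : Fin n → Euc n,
      ∫⁻ x, I (x, fun j => x - Z j) ≤ m * ∫⁻ u, K Z u := by
    filter_upwards [hmult] with Z hZ
    set ΩZ : Set (Euc n) := {x | x ∈ Ω ∧ ∀ j, x - Z j ∈ Ω} with hΩZ
    have hΩZm : MeasurableSet ΩZ := by
      have : ΩZ = (fun x => (x, fun j => x - Z j)) ⁻¹' S := rfl
      rw [this]
      exact (show Measurable fun x => (x, fun j => x - Z j) by fun_prop) hSm
    have hdZ : Measurable fun x => (diffDeriv φ Z x).det := by
      simp_rw [det_diffDeriv]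
      exact hdetm.comp (by fun_prop)
    have h1 := setLIntegral_abs_det_mul_comp_le volume hΩZm
      (fun x hx => hasStrictFDerivAt_diff hΩ hφ hx.1 hx.2) hdZ hZ
      (g := K Z) (hKm.comp measurable_prodMk_left)
    refine le_trans (le_of_eq ?_) h1
    rw [← lintegral_indicator hΩZm]
    refine lintegral_congr fun x => ?_
    by_cases hx : x ∈ ΩZ
    · have hxS : (x, fun j => x - Z j) ∈ S := hx
      rw [indicator_of_mem hx, hI, indicator_of_mem hxS, det_diffDeriv, mul_comm,
        abs_det_sub_comm (fun _ i => gradient φ x i)]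
      simp only [hG, hK, Function.uncurry, snocEuc_graph, snocEuc_sub, Prod.mk_sub_mk,
        sub_sub_cancel]
    · have hxS : (x, fun j => x - Z j) ∉ S := hx
      rw [indicator_of_notMem hx, hI, indicator_of_notMem hxS]
  calc _ = ∫⁻ x, ∫⁻ Z : Fin n → Euc n, I (x, fun j => x - Z j) := by
        rw [hLHS]; exact lintegral_congr hshift
    _ = ∫⁻ Z : Fin n → Euc n, ∫⁻ x, I (x, fun j => x - Z j) :=
        lintegral_lintegral_swap (by
          have : Measurable fun p : Euc n × (Fin n → Euc n) => I (p.1, fun j => p.1 - p.2 j) :=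
            hIm.comp (by fun_prop)
          exact this.aemeasurable)
    _ ≤ ∫⁻ Z : Fin n → Euc n, m * ∫⁻ u, K Z u := lintegral_mono_ae hpt
    _ = m * ∫⁻ Z : Fin n → Euc n, ∫⁻ u, K Z u :=
        lintegral_const_mul _ hKm.lintegral_prod_right
    _ = m * ∫⁻ p : (Fin n → Euc n) × Euc n, ∏ j, g (snocEuc (p.1 j, p.2 j)) := by
        rw [lintegral_lintegral hKm.aemeasurable]
        rfl
    _ = m * ∫⁻ W : Fin n → Euc (n + 1), ∏ j, g (W j) := by
        rw [(measurePreserving_pi_snocEuc n).lintegral_comp (f := fun W => ∏ j, g (W j))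
          (by fun_prop)]
    _ = m * (∫⁻ y, g y) ^ n := by
        rw [volume_pi, lintegral_pi_fin_prod volume (g := fun _ => g) fun _ => hg]
        simp

/-! ### The bilinear estimate -/

/-- The density of affine surface measure. -/
noncomputable def affineDensity {n : ℕ} (φ : Euc n → ℝ) (x : Euc n) : ℝ :=
  |hessianDet φ x| ^ (1 / ((n : ℝ) + 2))

@[fun_prop]
theorem measurable_affineDensity {n : ℕ} (φ : Euc n → ℝ) : Measurable (affineDensity φ) := by
  unfold affineDensity
  fun_prop

theorem affineDensity_nonneg {n : ℕ} (φ : Euc n → ℝ) (x : Euc n) : 0 ≤ affineDensity φ x := by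
  unfold affineDensity
  positivity

theorem ofReal_affineDensity_pow {n : ℕ} (φ : Euc n → ℝ) (x : Euc n) :
    ENNReal.ofReal (affineDensity φ x) ^ (n + 2) = ENNReal.ofReal |hessianDet φ x| := by
  rw [← ENNReal.ofReal_pow (affineDensity_nonneg φ x), affineDensity, ← Real.rpow_natCast,
    ← Real.rpow_mul (abs_nonneg _)]
  have h : (1 / ((n : ℝ) + 2)) * ((n + 2 : ℕ) : ℝ) = 1 := by
    push_cast
    field_simp
  rw [h, Real.rpow_one]

theorem setLIntegral_pow_le {n : ℕ} (hn : 2 ≤ n) {φ : Euc n → ℝ} {Ω : Set (Euc n)} (hΩ : IsOpen Ω)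
    (hφ : ContDiffOn ℝ 2 φ Ω) {l : ℕ} (hl : GenericMultiplicityLE (gradient φ) Ω l)
    {A : Set (Euc n)} (hA : MeasurableSet A) (hAΩ : A ⊆ Ω) {x : Euc n} (hx : 0 < affineDensity φ x)
    (hxA : ∀ y ∈ A, affineDensity φ x ≤ affineDensity φ y) {F : Euc n → ℝ} (hF : Measurable F)
    (hFA : ∀ y ∈ A, 1 ≤ F y) :
    (∫⁻ y in A, ENNReal.ofReal (F y * affineDensity φ y)) ^ (n + 1) ≤
      (n + 1) * l * radialConst n ^ n * (ENNReal.ofReal (affineDensity φ x))⁻¹ *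
        ∫⁻ Y : Fin n → Euc n, (∏ j, ENNReal.ofReal (F (Y j)) ^ 2) *
          ENNReal.ofReal |(Matrix.of fun j i => gradient φ (Y j) i - gradient φ x i).det|
          ∂(Measure.pi fun _ => volume.restrict Ω) := by
  classical
  set w : Euc n → ℝ := A.piecewise (affineDensity φ) fun _ => affineDensity φ x with hw
  set G : Euc n → ℝ := A.piecewise F fun _ => 1 with hG
  have hwA : ∀ y ∈ A, w y = affineDensity φ y := fun y hy => piecewise_eq_of_mem _ _ _ hy
  have hGA : ∀ y ∈ A, G y = F y := fun y hy => piecewise_eq_of_mem _ _ _ hy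
  have hwm : Measurable w := Measurable.piecewise hA (by fun_prop) (by fun_prop)
  have hGm : Measurable G := Measurable.piecewise hA (by fun_prop) (by fun_prop)
  set f : Euc n → Fin n → ℝ := fun y i => gradient φ y i - gradient φ x i with hf
  have hfm : Measurable f := by fun_prop
  have hdens : ∀ g : (Fin n → ℝ) → ℝ≥0∞, Measurable g →
      ∫⁻ y in A, ENNReal.ofReal (w y) ^ (n + 2) * g (f y) ≤ (l : ℝ≥0∞) * ∫⁻ v, g v := by
    intro g hg
    have hgm : Measurable fun v : Euc n => g (WithLp.ofLp (v - gradient φ x)) :=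
      hg.comp (by fun_prop)
    calc _ = ∫⁻ y in A, ENNReal.ofReal |(fderiv ℝ (gradient φ) y).det| * g (f y) := by
          refine setLIntegral_congr_fun hA fun y hy => ?_
          simp only [hwA y hy, ofReal_affineDensity_pow]
          rfl
      _ ≤ ∫⁻ y in Ω, ENNReal.ofReal |(fderiv ℝ (gradient φ) y).det| * g (f y) :=
          lintegral_mono_set hAΩ
      _ ≤ l * ∫⁻ v : Euc n, g (WithLp.ofLp (v - gradient φ x)) :=
          setLIntegral_abs_det_mul_comp_le volume hΩ.measurableSet
            (fun y hy => hasStrictFDerivAt_gradient (hφ.contDiffAt (hΩ.mem_nhds hy)))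
            (measurable_hessianDet φ) hl hgm
      _ = l * ∫⁻ v : Euc n, g (WithLp.ofLp v) := by
          rw [lintegral_sub_right_eq_self fun v : Euc n => g (WithLp.ofLp v)]
      _ = l * ∫⁻ v, g v := by
          rw [(PiLp.volume_preserving_ofLp (Fin n)).lintegral_comp hg]
  have key := lintegral_pow_le_lintegral_det (n := n) (by omega) (volume.restrict A) hfm hwm hGm hx
    (fun y => by
      by_cases hy : y ∈ A
      · rw [hwA y hy]; exact hxA y hy
      · rw [hw, piecewise_eq_of_notMem _ _ _ hy])
    (fun y => by
      by_cases hy : y ∈ A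
      · rw [hGA y hy]; exact hFA y hy
      · rw [hG, piecewise_eq_of_notMem _ _ _ hy])
    hdens
  have e1 : ∫⁻ y in A, ENNReal.ofReal (F y * affineDensity φ y)
      = ∫⁻ y in A, ENNReal.ofReal (G y * w y) :=
    setLIntegral_congr_fun hA fun y hy => by simp only [hwA y hy, hGA y hy]
  rw [e1]
  refine key.trans ?_
  refine mul_le_mul_right ?_ _
  have hpi : ∀ B : Set (Euc n), (Measure.pi fun _ : Fin n => (volume : Measure (Euc n)).restrict B)
      = (Measure.pi fun _ : Fin n => (volume : Measure (Euc n))).restrict (univ.pi fun _ => B) :=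
    fun B => (Measure.restrict_pi_pi _ _).symm
  rw [hpi, hpi]
  calc _ = ∫⁻ Y in univ.pi fun _ : Fin n => A, (∏ j, ENNReal.ofReal (F (Y j)) ^ 2) *
          ENNReal.ofReal |(Matrix.of fun j i => gradient φ (Y j) i - gradient φ x i).det|
          ∂(Measure.pi fun _ => volume) := by
        refine setLIntegral_congr_fun (MeasurableSet.univ_pi fun _ => hA) fun Y hY => ?_
        have : ∀ j, G (Y j) = F (Y j) := fun j => hGA _ (hY j (mem_univ j))
        simp only [this]
        rfl
    _ ≤ _ := lintegral_mono_set (pi_mono fun _ _ => hAΩ)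

/-- The measure `|det H|^(1/(n+2)) dx` on `Ω`. -/
noncomputable def affineMeasure {n : ℕ} (Ω : Set (Euc n)) (φ : Euc n → ℝ) : Measure (Euc n) :=
  (volume.restrict Ω).withDensity fun x => ENNReal.ofReal (affineDensity φ x)

instance {n : ℕ} (Ω : Set (Euc n)) (φ : Euc n → ℝ) : SigmaFinite (affineMeasure Ω φ) :=
  SigmaFinite.withDensity_ofReal _

theorem setLIntegral_affineMeasure {n : ℕ} (Ω : Set (Euc n)) (φ : Euc n → ℝ) {E : Set (Euc n)}
    (hE : MeasurableSet E) {f : Euc n → ℝ≥0∞} (hf : Measurable f) :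
    ∫⁻ x in E, f x ∂(affineMeasure Ω φ)
      = ∫⁻ x in E ∩ Ω, ENNReal.ofReal (affineDensity φ x) * f x := by
  rw [affineMeasure, restrict_withDensity hE, Measure.restrict_restrict hE,
    lintegral_withDensity_eq_lintegral_mul _ (by fun_prop) hf]
  rfl

theorem lintegral_ordered_le {n : ℕ} (hn : 2 ≤ n) {φ : Euc n → ℝ} {Ω : Set (Euc n)}
    (hΩ : IsOpen Ω) (hφ : ContDiffOn ℝ 2 φ Ω) (hφm : Measurable φ) {l m : ℕ}
    (hl : GenericMultiplicityLE (gradient φ) Ω l)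
    (hm : GenericMultiplicityLE (diffMap φ) (powSet Ω) m)
    {E : Set (Euc n)} (hE : MeasurableSet E) {h : Euc (n + 1) → ℝ} (hh : Measurable h) :
    ∫⁻ x in E, ∫⁻ y in E, {p : Euc n × Euc n | affineDensity φ p.1 ≤ affineDensity φ p.2}.indicator
        (fun p => ENNReal.ofReal (h (graphMap φ p.1 - graphMap φ p.2))) (x, y)
        ∂(affineMeasure Ω φ) ∂(affineMeasure Ω φ)
      ≤ affineMeasure Ω φ E ^ 2 +
        ((n + 1) * l * radialConst n ^ n * m * (∫⁻ z, ENNReal.ofReal (h z) ^ 2) ^ n)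
          ^ (1 / ((n : ℝ) + 1)) * affineMeasure Ω φ E ^ ((n : ℝ) / (n + 1)) := by
  have hΩm := hΩ.measurableSet
  have hγ := measurable_graphMap hφm
  set μ := affineMeasure Ω φ with hμ
  set w := affineDensity φ with hw
  set C := (n + 1) * l * radialConst n ^ n with hC
  set H := ∫⁻ z, ENNReal.ofReal (h z) ^ 2 with hH
  set S : Set (Euc n × Euc n) := {p | w p.1 ≤ w p.2} with hS
  have hSm : MeasurableSet S := measurableSet_le (by fun_prop) (by fun_prop)
  set B : Set (Euc n × Euc n) := {p | 1 < h (graphMap φ p.1 - graphMap φ p.2)} with hB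
  have hkm : Measurable fun p : Euc n × Euc n => h (graphMap φ p.1 - graphMap φ p.2) := by fun_prop
  have hBm : MeasurableSet B := measurableSet_lt measurable_const hkm
  set k : Euc n × Euc n → ℝ≥0∞ := fun p => ENNReal.ofReal (h (graphMap φ p.1 - graphMap φ p.2))
  have hkm' : Measurable k := by fun_prop
  set T : Euc n → ℝ≥0∞ := fun x => ∫⁻ y in E, (S ∩ B).indicator k (x, y) ∂μ with hT
  have hTm : Measurable T := (hkm'.indicator (hSm.inter hBm)).lintegral_prod_right'
  have hpt : ∀ p, S.indicator k p ≤ 1 + (S ∩ B).indicator k p := by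
    intro p
    by_cases hpS : p ∈ S
    · by_cases hpB : p ∈ B
      · rw [indicator_of_mem hpS, indicator_of_mem (show p ∈ S ∩ B from ⟨hpS, hpB⟩)]
        exact le_add_self
      · rw [indicator_of_mem hpS]
        have : h (graphMap φ p.1 - graphMap φ p.2) ≤ 1 := not_lt.1 hpB
        exact le_add_right (ENNReal.ofReal_le_one.2 this)
    · rw [indicator_of_notMem hpS]
      exact zero_le
  have hCt : C ≠ ∞ := by
    have := (radialConst_lt_top hn).ne
    rw [hC]
    finiteness
  have hTpow : ∀ x, 0 < w x → ENNReal.ofReal (w x) * T x ^ (n + 1) ≤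
      C * ∫⁻ Y : Fin n → Euc n, (∏ j, ENNReal.ofReal (h (graphMap φ x - graphMap φ (Y j))) ^ 2) *
          ENNReal.ofReal |(Matrix.of fun j i => gradient φ (Y j) i - gradient φ x i).det|
          ∂(Measure.pi fun _ => volume.restrict Ω) := by
    intro x hx
    set A : Set (Euc n) := (E ∩ Ω) ∩ (fun y => (x, y)) ⁻¹' (S ∩ B) with hA
    have hAm : MeasurableSet A :=
      (hE.inter hΩm).inter (measurable_prodMk_left (hSm.inter hBm))
    have e1 : T x = ∫⁻ y in A, ENNReal.ofReal (h (graphMap φ x - graphMap φ y) * w y) := by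
      simp only [hT]
      have hmk : Measurable fun y => (S ∩ B).indicator k (x, y) :=
        (hkm'.indicator (hSm.inter hBm)).comp measurable_prodMk_left
      rw [setLIntegral_affineMeasure Ω φ hE hmk, ← lintegral_indicator (hE.inter hΩm), ← lintegral_indicator hAm]
      refine lintegral_congr fun y => ?_
      by_cases hy : y ∈ E ∩ Ω
      · by_cases hy' : (x, y) ∈ S ∩ B
        · rw [indicator_of_mem hy, indicator_of_mem (show y ∈ A from ⟨hy, hy'⟩), indicator_of_mem hy',
            mul_comm, ← ENNReal.ofReal_mul (zero_le_one.trans (le_of_lt hy'.2))]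
        · rw [indicator_of_mem hy, indicator_of_notMem (fun h : y ∈ A => hy' h.2), indicator_of_notMem hy',
            mul_zero]
      · rw [indicator_of_notMem hy, indicator_of_notMem (fun h : y ∈ A => hy h.1)]
    have hw0 : ENNReal.ofReal (w x) ≠ 0 := by simpa using hx
    have hF : Measurable fun y => h (graphMap φ x - graphMap φ y) := by fun_prop
    have key := setLIntegral_pow_le hn hΩ hφ hl hAm (fun y hy => hy.1.2) hx
      (fun y hy => hy.2.1) hF (fun y hy => le_of_lt hy.2.2)
    have hcancel : ∀ J : ℝ≥0∞, ENNReal.ofReal (w x) * (C * (ENNReal.ofReal (w x))⁻¹ * J) = C * J := by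
      intro J
      calc _ = (ENNReal.ofReal (w x) * (ENNReal.ofReal (w x))⁻¹) * (C * J) := by ring
        _ = _ := by rw [ENNReal.mul_inv_cancel hw0 ENNReal.ofReal_ne_top, one_mul]
    rw [e1]
    exact (mul_le_mul_right key _).trans (hcancel _).le
  have hpow : ∫⁻ x in E, T x ^ ((n : ℝ) + 1) ∂μ ≤ C * m * H ^ n := by
    have e0 : ∀ x, T x ^ ((n : ℝ) + 1) = T x ^ (n + 1) := fun x => by
      rw [← ENNReal.rpow_natCast]; norm_cast
    simp_rw [e0]
    rw [setLIntegral_affineMeasure Ω φ hE (by fun_prop)]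
    calc _ ≤ ∫⁻ x in E ∩ Ω, C * ∫⁻ Y : Fin n → Euc n,
          (∏ j, ENNReal.ofReal (h (graphMap φ x - graphMap φ (Y j))) ^ 2) *
          ENNReal.ofReal |(Matrix.of fun j i => gradient φ (Y j) i - gradient φ x i).det|
          ∂(Measure.pi fun _ => volume.restrict Ω) := by
          refine lintegral_mono fun x => ?_
          rcases (affineDensity_nonneg φ x).eq_or_lt with h0 | h0
          · simp only [← h0, ENNReal.ofReal_zero, zero_mul]
            exact zero_le
          · exact hTpow x h0
      _ ≤ ∫⁻ x in Ω, C * ∫⁻ Y : Fin n → Euc n,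
          (∏ j, ENNReal.ofReal (h (graphMap φ x - graphMap φ (Y j))) ^ 2) *
          ENNReal.ofReal |(Matrix.of fun j i => gradient φ (Y j) i - gradient φ x i).det|
          ∂(Measure.pi fun _ => volume.restrict Ω) := lintegral_mono_set inter_subset_right
      _ ≤ C * (m * H ^ n) := by
          rw [lintegral_const_mul' _ _ hCt]
          gcongr
          exact lintegral_prod_diff_mul_det_le hΩ hφ hφm hm
            (g := fun z => ENNReal.ofReal (h z) ^ 2) (by fun_prop)
      _ = _ := by ring
  have hn1 : (0 : ℝ) < n + 1 := by positivity
  have hn0 : (0 : ℝ) < n := by exact_mod_cast (by omega : 0 < n)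
  have hconj : ((n : ℝ) + 1).HolderConjugate (((n : ℝ) + 1) / n) := by
    rw [Real.holderConjugate_iff]
    refine ⟨by linarith, ?_⟩
    field_simp
    ring
  have hhol : ∫⁻ x in E, T x ∂μ ≤ (C * m * H ^ n) ^ (1 / ((n : ℝ) + 1)) * μ E ^ ((n : ℝ) / (n + 1)) := by
    have := ENNReal.lintegral_mul_le_Lp_mul_Lq (μ.restrict E) hconj hTm.aemeasurable
      (g := fun _ => 1) aemeasurable_const
    simp only [Pi.mul_apply, mul_one, ENNReal.one_rpow, lintegral_const, one_mul,
      Measure.restrict_apply_univ, one_div_div] at this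
    refine this.trans ?_
    gcongr
  calc _ ≤ ∫⁻ x in E, ∫⁻ y in E, (1 + (S ∩ B).indicator k (x, y)) ∂μ ∂μ :=
        lintegral_mono fun x => lintegral_mono fun y => hpt (x, y)
    _ = ∫⁻ x in E, (μ E + T x) ∂μ := by
        refine lintegral_congr fun x => ?_
        rw [lintegral_add_left measurable_const]
        simp [hT]
    _ = μ E ^ 2 + ∫⁻ x in E, T x ∂μ := by
        rw [lintegral_add_left measurable_const]
        simp [sq]
    _ ≤ _ := by gcongr

theorem le_of_forall_scaling {n : ℕ} (hn : n ≠ 0) {L Λ H K : ℝ≥0∞} (hΛ : Λ ≠ ∞)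
    (hL : Λ = 0 → L = 0)
    (h : ∀ s : ℝ, 0 < s → ENNReal.ofReal s * L ≤
      2 * (Λ ^ 2 + (K * (ENNReal.ofReal s ^ 2 * H) ^ n) ^ (1 / ((n : ℝ) + 1)) *
        Λ ^ ((n : ℝ) / (n + 1)))) :
    L ≤ 2 * (1 + K ^ (1 / ((n : ℝ) + 1))) * Λ ^ (3 / 2 - 1 / n : ℝ) * H ^ (1 / 2 : ℝ) := by
  have hn' : (0 : ℝ) < n := by exact_mod_cast Nat.pos_of_ne_zero hn
  have hn1 : (0 : ℝ) < (n : ℝ) + 1 := by positivity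
  have hinv : 0 < 1 / ((n : ℝ) + 1) := by positivity
  rcases eq_or_ne Λ 0 with hΛ0 | hΛ0
  · rw [hL hΛ0]; exact zero_le
  rcases eq_or_ne H ∞ with hH | hH
  · rw [hH, ENNReal.top_rpow_of_pos (by norm_num), ENNReal.mul_top]
    · exact le_top
    · refine mul_ne_zero (mul_ne_zero two_ne_zero (by simp)) ?_
      simp [ENNReal.rpow_eq_zero_iff, hΛ0, hΛ]
  rcases eq_or_ne H 0 with hH0 | hH0
  · have h1 : ∀ s : ℝ, 0 < s → ENNReal.ofReal s * L ≤ 2 * Λ ^ 2 := by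
      intro s hs
      have := h s hs
      rwa [hH0, mul_zero, zero_pow hn, mul_zero, ENNReal.zero_rpow_of_pos hinv, zero_mul,
        add_zero] at this
    have hfin : 2 * Λ ^ 2 ≠ ∞ := by finiteness
    suffices hL0 : L = 0 by rw [hL0]; exact zero_le
    by_contra hL0
    have hLt : L ≠ ∞ := by
      intro ht
      have := h1 1 one_pos
      rw [ht, ENNReal.ofReal_one, one_mul, top_le_iff] at this
      exact hfin this
    have hs0 : (2 * Λ ^ 2 + 1) / L ≠ ∞ := ENNReal.div_ne_top (by finiteness) hL0
    have hs1 : (2 * Λ ^ 2 + 1) / L ≠ 0 := by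
      simp [ENNReal.div_eq_zero_iff, hLt]
    have := h1 _ (ENNReal.toReal_pos hs1 hs0)
    rw [ENNReal.ofReal_toReal hs0, ENNReal.div_mul_cancel hL0 hLt] at this
    exact absurd this (not_le.2 (ENNReal.lt_add_right hfin one_ne_zero))
  set α : ℝ := (n + 2) / (2 * n) with hα
  set σ : ℝ≥0∞ := Λ ^ α * H ^ (-(1 / 2) : ℝ) with hσ
  have hσt : σ ≠ ∞ := ENNReal.mul_ne_top (ENNReal.rpow_ne_top_of_ne_zero hΛ0 hΛ)
    (ENNReal.rpow_ne_top_of_ne_zero hH0 hH)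
  have hσ0 : σ ≠ 0 := mul_ne_zero (by simp [ENNReal.rpow_eq_zero_iff, hΛ0, hΛ])
    (by simp [ENNReal.rpow_eq_zero_iff, hH0, hH])
  have h1 := h σ.toReal (ENNReal.toReal_pos hσ0 hσt)
  rw [ENNReal.ofReal_toReal hσt] at h1
  have e1 : σ ^ 2 * H = Λ ^ (2 * α) := by
    rw [hσ, mul_pow, ← ENNReal.rpow_natCast, ← ENNReal.rpow_natCast, ← ENNReal.rpow_mul,
      ← ENNReal.rpow_mul]
    have : (-(1 / 2) : ℝ) * ((2 : ℕ) : ℝ) = -1 := by norm_num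
    rw [this, ENNReal.rpow_neg_one, mul_assoc, ENNReal.inv_mul_cancel hH0 hH, mul_one]
    congr 1
    push_cast
    ring
  have e2 : (K * (σ ^ 2 * H) ^ n) ^ (1 / ((n : ℝ) + 1)) * Λ ^ ((n : ℝ) / (n + 1))
      = K ^ (1 / ((n : ℝ) + 1)) * Λ ^ 2 := by
    rw [e1, ENNReal.mul_rpow_of_nonneg _ _ hinv.le, ← ENNReal.rpow_natCast, ← ENNReal.rpow_mul,
      ← ENNReal.rpow_mul, mul_assoc, ← ENNReal.rpow_add _ _ hΛ0 hΛ, ← ENNReal.rpow_natCast]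
    congr 2
    rw [hα]
    push_cast
    field_simp
    ring
  rw [e2] at h1
  calc L = σ⁻¹ * (σ * L) := by
        rw [← mul_assoc, ENNReal.inv_mul_cancel hσ0 hσt, one_mul]
    _ ≤ σ⁻¹ * (2 * (Λ ^ 2 + K ^ (1 / ((n : ℝ) + 1)) * Λ ^ 2)) := mul_le_mul_right h1 _
    _ = 2 * (1 + K ^ (1 / ((n : ℝ) + 1))) * (Λ ^ 2 * σ⁻¹) := by ring
    _ = _ := by
        rw [mul_assoc _ (Λ ^ _) (H ^ _)]
        congr 1
        rw [hσ, ENNReal.mul_inv (Or.inl (by simp [ENNReal.rpow_eq_zero_iff, hΛ0, hΛ]))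
          (Or.inl (ENNReal.rpow_ne_top_of_ne_zero hΛ0 hΛ)), ← ENNReal.rpow_neg, ← ENNReal.rpow_neg,
          neg_neg, ← mul_assoc, ← ENNReal.rpow_natCast, ← ENNReal.rpow_add _ _ hΛ0 hΛ]
        congr 2
        rw [hα]
        push_cast
        field_simp
        ring

/-- The constant in the bilinear estimate. -/
noncomputable def bilinearConst (n l m : ℕ) : ℝ≥0∞ :=
  2 * (1 + ((n + 1) * l * radialConst n ^ n * m) ^ (1 / ((n : ℝ) + 1)))

theorem bilinearConst_ne_top {n : ℕ} (hn : 2 ≤ n) (l m : ℕ) : bilinearConst n l m ≠ ∞ := by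
  have := (radialConst_lt_top hn).ne
  have h2 : ((n : ℝ≥0∞) + 1) * l * radialConst n ^ n * m ≠ ∞ := by finiteness
  unfold bilinearConst
  have h3 := ENNReal.rpow_ne_top_of_nonneg (y := 1 / ((n : ℝ) + 1)) (by positivity) h2
  finiteness

theorem lintegral_lintegral_affineMeasure_le {n : ℕ} (hn : 2 ≤ n) {φ : Euc n → ℝ} {Ω : Set (Euc n)}
    (hΩ : IsOpen Ω) (hφ : ContDiffOn ℝ 2 φ Ω) (hφm : Measurable φ) {l m : ℕ}
    (hl : GenericMultiplicityLE (gradient φ) Ω l)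
    (hm : GenericMultiplicityLE (diffMap φ) (powSet Ω) m)
    {E : Set (Euc n)} (hE : MeasurableSet E) (hEt : affineMeasure Ω φ E ≠ ∞)
    {h : Euc (n + 1) → ℝ} (hh : Measurable h) :
    ∫⁻ x in E, ∫⁻ y in E, ENNReal.ofReal (h (graphMap φ x - graphMap φ y))
        ∂(affineMeasure Ω φ) ∂(affineMeasure Ω φ)
      ≤ bilinearConst n l m * affineMeasure Ω φ E ^ (3 / 2 - 1 / n : ℝ) *
        (∫⁻ z, ENNReal.ofReal (h z) ^ 2) ^ (1 / 2 : ℝ) := by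
  have hγ := measurable_graphMap hφm
  set μ := affineMeasure Ω φ with hμ
  set w := affineDensity φ with hw
  set S : Set (Euc n × Euc n) := {p | w p.1 ≤ w p.2} with hS
  have hSm : MeasurableSet S := measurableSet_le (by fun_prop) (by fun_prop)
  let k : (Euc (n + 1) → ℝ) → Euc n × Euc n → ℝ≥0∞ := fun h p =>
    ENNReal.ofReal (h (graphMap φ p.1 - graphMap φ p.2))
  have hkm : ∀ h, Measurable h → Measurable (k h) := fun h hh => by
    simp only [k]
    fun_prop
  have hsplit : ∀ h : Euc (n + 1) → ℝ, Measurable h →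
      ∫⁻ x in E, ∫⁻ y in E, k h (x, y) ∂μ ∂μ ≤
      2 * (μ E ^ 2 + ((n + 1) * l * radialConst n ^ n * m * (∫⁻ z, ENNReal.ofReal (h z) ^ 2) ^ n)
          ^ (1 / ((n : ℝ) + 1)) * μ E ^ ((n : ℝ) / (n + 1))) := by
    intro h hh
    have hneg : Measurable fun z => h (-z) := by fun_prop
    have h1 := lintegral_ordered_le hn hΩ hφ hφm hl hm hE hh
    have h2 := lintegral_ordered_le hn hΩ hφ hφm hl hm hE hneg
    have e1 : ∫⁻ z, ENNReal.ofReal (h (-z)) ^ 2 = ∫⁻ z, ENNReal.ofReal (h z) ^ 2 :=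
      (Measure.measurePreserving_neg (volume : Measure (Euc (n + 1)))).lintegral_comp
        (f := fun z => ENNReal.ofReal (h z) ^ 2) (by fun_prop)
    rw [e1] at h2
    have hm1 : Measurable (S.indicator (k h)) := (hkm h hh).indicator hSm
    have hm2 : Measurable (S.indicator (k fun z => h (-z))) := (hkm _ hneg).indicator hSm
    have hle : ∀ x y, k h (x, y) ≤ S.indicator (k h) (x, y) +
        S.indicator (k fun z => h (-z)) (y, x) := by
      intro x y
      rcases le_total (w x) (w y) with hxy | hxy
      · rw [indicator_of_mem (show (x, y) ∈ S from hxy)]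
        exact le_self_add
      · rw [indicator_of_mem (show (y, x) ∈ S from hxy) (k fun z => h (-z))]
        have : k (fun z => h (-z)) (y, x) = k h (x, y) := by simp [k]
        rw [this]
        exact le_add_self
    calc _ ≤ ∫⁻ x in E, ∫⁻ y in E, (S.indicator (k h) (x, y) +
          S.indicator (k fun z => h (-z)) (y, x)) ∂μ ∂μ :=
          lintegral_mono fun x => lintegral_mono fun y => hle x y
      _ = ∫⁻ x in E, ∫⁻ y in E, S.indicator (k h) (x, y) ∂μ ∂μ +
          ∫⁻ x in E, ∫⁻ y in E, S.indicator (k fun z => h (-z)) (y, x) ∂μ ∂μ := by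
          rw [← lintegral_add_left hm1.lintegral_prod_right']
          refine lintegral_congr fun x => ?_
          have : Measurable fun y => S.indicator (k h) (x, y) := hm1.comp measurable_prodMk_left
          rw [lintegral_add_left this]
      _ = ∫⁻ x in E, ∫⁻ y in E, S.indicator (k h) (x, y) ∂μ ∂μ +
          ∫⁻ x in E, ∫⁻ y in E, S.indicator (k fun z => h (-z)) (x, y) ∂μ ∂μ := by
          congr 1
          exact lintegral_lintegral_swap (f := fun x y => S.indicator (k fun z => h (-z)) (y, x))
            (hm2.comp measurable_swap).aemeasurable
      _ ≤ _ := by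
          rw [two_mul]
          exact add_le_add h1 h2
  refine le_of_forall_scaling (by omega) hEt (fun h0 => ?_) fun s hs => ?_
  · rw [Measure.restrict_eq_zero.2 h0]
    simp
  · have hs' := hsplit (fun z => s * h z) (by fun_prop)
    have e1 : ∫⁻ z, ENNReal.ofReal (s * h z) ^ 2
        = ENNReal.ofReal s ^ 2 * ∫⁻ z, ENNReal.ofReal (h z) ^ 2 := by
      rw [← lintegral_const_mul _ (by fun_prop)]
      refine lintegral_congr fun z => ?_
      rw [ENNReal.ofReal_mul hs.le, mul_pow]
    rw [e1] at hs'
    refine le_trans (le_of_eq ?_) hs'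
    simp only [k, ENNReal.ofReal_mul hs.le]
    have h1 : Measurable fun p : Euc n × Euc n =>
        ENNReal.ofReal (h (graphMap φ p.1 - graphMap φ p.2)) := hkm h hh
    rw [← lintegral_const_mul _ h1.lintegral_prod_right']
    refine lintegral_congr fun x => ?_
    rw [lintegral_const_mul _ (by fun_prop)]

theorem affineSurfaceMeasure_eq {n : ℕ} (Ω : Set (Euc n)) (φ : Euc n → ℝ) :
    affineSurfaceMeasure Ω φ = (affineMeasure Ω φ).map (graphMap φ) := rfl

theorem sigmaFinite_affineSurfaceMeasure {n : ℕ} (Ω : Set (Euc n)) {φ : Euc n → ℝ}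
    (hφm : Measurable φ) : SigmaFinite (affineSurfaceMeasure Ω φ) := by
  let π : Euc (n + 1) → Euc n := fun z => WithLp.toLp 2 fun i => z i.castSucc
  have hπ : Measurable π := by fun_prop
  have h1 : (affineSurfaceMeasure Ω φ).map π = affineMeasure Ω φ := by
    rw [affineSurfaceMeasure_eq, Measure.map_map hπ (measurable_graphMap hφm)]
    convert Measure.map_id
    ext x i
    simp [π, graphMap]
  have h2 : SigmaFinite ((affineSurfaceMeasure Ω φ).map π) := by rw [h1]; infer_instance
  exact SigmaFinite.of_map _ hπ.aemeasurable h2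

theorem lintegral_lintegral_affineSurfaceMeasure_le {n : ℕ} (hn : 2 ≤ n) {φ : Euc n → ℝ}
    {Ω : Set (Euc n)} (hΩ : IsOpen Ω) (hφ : ContDiffOn ℝ 2 φ Ω) (hφm : Measurable φ) {l m : ℕ}
    (hl : GenericMultiplicityLE (gradient φ) Ω l)
    (hm : GenericMultiplicityLE (diffMap φ) (powSet Ω) m)
    {E : Set (Euc (n + 1))} (hE : MeasurableSet E) (hEt : affineSurfaceMeasure Ω φ E ≠ ∞)
    {h : Euc (n + 1) → ℝ} (hh : Measurable h) :
    ∫⁻ u in E, ∫⁻ v in E, ENNReal.ofReal (h (u - v))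
        ∂(affineSurfaceMeasure Ω φ) ∂(affineSurfaceMeasure Ω φ)
      ≤ bilinearConst n l m * affineSurfaceMeasure Ω φ E ^ (3 / 2 - 1 / n : ℝ) *
        (∫⁻ z, ENNReal.ofReal (h z) ^ 2) ^ (1 / 2 : ℝ) := by
  have := sigmaFinite_affineSurfaceMeasure Ω hφm
  have hγ := measurable_graphMap hφm
  have hk : Measurable fun p : Euc (n + 1) × Euc (n + 1) => ENNReal.ofReal (h (p.1 - p.2)) := by
    fun_prop
  have h0 : ∫⁻ u in E, ∫⁻ v in E, ENNReal.ofReal (h (u - v))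
        ∂(affineSurfaceMeasure Ω φ) ∂(affineSurfaceMeasure Ω φ)
      = ∫⁻ x in graphMap φ ⁻¹' E, ∫⁻ v in E, ENNReal.ofReal (h (graphMap φ x - v))
        ∂(affineSurfaceMeasure Ω φ) ∂(affineMeasure Ω φ) :=
    setLIntegral_map hE (f := fun u => ∫⁻ v in E, ENNReal.ofReal (h (u - v))
        ∂(affineSurfaceMeasure Ω φ)) hk.lintegral_prod_right' hγ
  rw [h0]
  have h1 : ∀ x, ∫⁻ v in E, ENNReal.ofReal (h (graphMap φ x - v)) ∂(affineSurfaceMeasure Ω φ)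
      = ∫⁻ y in graphMap φ ⁻¹' E, ENNReal.ofReal (h (graphMap φ x - graphMap φ y))
        ∂(affineMeasure Ω φ) := fun x =>
    setLIntegral_map hE (f := fun v => ENNReal.ofReal (h (graphMap φ x - v)))
      (hk.comp measurable_prodMk_left) hγ
  have h2 : affineSurfaceMeasure Ω φ E = affineMeasure Ω φ (graphMap φ ⁻¹' E) :=
    Measure.map_apply hγ hE
  simp only [h1]
  rw [h2] at hEt ⊢
  exact lintegral_lintegral_affineMeasure_le hn hΩ hφ hφm hl hm (hγ hE) hEt hh

/-! ### Plancherel on `L^1 ∩ L^2` -/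

theorem continuous_fourier {k : ℕ} {ψ : Euc k → ℂ} (hψ : Integrable ψ) : Continuous (𝓕 ψ) :=
  VectorFourier.fourierIntegral_continuous Real.continuous_fourierChar
    (innerSL ℝ).continuous₂ hψ

theorem coeFn_fourier_toLp {k : ℕ} {ψ : Euc k → ℂ} (h1 : Integrable ψ) (h2 : MemLp ψ 2) :
    (𝓕 (h2.toLp ψ) : Lp ℂ 2 (volume : Measure (Euc k))) =ᵐ[volume] 𝓕 ψ := by
  refine ae_eq_of_integral_contDiff_smul_eq
    ((Lp.memLp _).locallyIntegrable (by norm_num)) (continuous_fourier h1).locallyIntegrable ?_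
  intro g hg hgc
  have hg' : ContDiff ℝ ((⊤ : ℕ∞) : WithTop ℕ∞) fun x => (g x : ℂ) :=
    Complex.ofRealCLM.contDiff.comp hg
  have hgc' : HasCompactSupport fun x => (g x : ℂ) :=
    hgc.comp_left (g := fun t : ℝ => (t : ℂ)) Complex.ofReal_zero
  let G : SchwartzMap (Euc k) ℂ := hgc'.toSchwartzMap hg'
  have hG : ∀ x, G x = (g x : ℂ) := fun x => rfl
  have key := congrArg (fun T => T G) (Lp.fourier_toTemperedDistribution_eq (h2.toLp ψ))
  simp only [TemperedDistribution.fourier_apply, Lp.toTemperedDistribution_apply] at key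
  have hself := VectorFourier.integral_fourierIntegral_smul_eq_flip (L := innerₗ (Euc k))
    Real.continuous_fourierChar continuous_inner (G.integrable (μ := volume)) h1
  have e1 : ∫ x, g x • (𝓕 (h2.toLp ψ) : Lp ℂ 2 (volume : Measure (Euc k))) x
      = ∫ x, G x • (𝓕 (h2.toLp ψ) : Lp ℂ 2 (volume : Measure (Euc k))) x := by
    simp [hG]
  have e2 : ∫ x, g x • 𝓕 ψ x = ∫ x, G x • 𝓕 ψ x := by
    simp [hG]
  rw [e1, e2, ← key]
  calc _ = ∫ x, (𝓕 G) x • ψ x := by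
        refine integral_congr_ae ?_
        filter_upwards [h2.coeFn_toLp] with x hx
        rw [hx]
    _ = ∫ x, G x • 𝓕 ψ x := by
        convert hself using 1
        · simp only [SchwartzMap.fourier_coe]
          rfl
        · simp only [flip_innerₗ]
          rfl

theorem lintegral_enorm_fourier_sq {k : ℕ} {ψ : Euc k → ℂ} (h1 : Integrable ψ) (h2 : MemLp ψ 2) :
    ∫⁻ x, ‖𝓕 ψ x‖ₑ ^ 2 = ∫⁻ x, ‖ψ x‖ₑ ^ 2 := by
  have e : ∀ f : Euc k → ℂ, eLpNorm f 2 volume = (∫⁻ x, ‖f x‖ₑ ^ 2) ^ (1 / 2 : ℝ) := by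
    intro f
    rw [eLpNorm_eq_lintegral_rpow_enorm_toReal two_ne_zero ENNReal.ofNat_ne_top]
    simp
  have h3 : eLpNorm (𝓕 ψ) 2 volume = eLpNorm ψ 2 volume := by
    rw [← eLpNorm_congr_ae (coeFn_fourier_toLp h1 h2), ← eLpNorm_congr_ae h2.coeFn_toLp,
      ← Lp.enorm_def, ← Lp.enorm_def, ← ofReal_norm, ← ofReal_norm, Lp.norm_fourier_eq]
  rw [e, e] at h3
  exact ENNReal.rpow_left_injective (by norm_num) h3

/-! ### The extension operator -/

/-- The bilinear bound satisfied by a measure whose extension operator is to be estimated. -/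
def BilinearBound {k : ℕ} (μ : Measure (Euc k)) (A : ℝ≥0∞) (β : ℝ) : Prop :=
  ∀ E : Set (Euc k), MeasurableSet E → μ E ≠ ∞ → ∀ h : Euc k → ℝ, Measurable h →
    ∫⁻ u in E, ∫⁻ v in E, ENNReal.ofReal (h (u - v)) ∂μ ∂μ
      ≤ A * μ E ^ β * (∫⁻ z, ENNReal.ofReal (h z) ^ 2) ^ (1 / 2 : ℝ)

/-- The Fourier integral of the complex measure `g μ`. -/
noncomputable def extension {k : ℕ} (μ : Measure (Euc k)) (g : Euc k → ℂ) (x : Euc k) : ℂ :=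
  ∫ ξ, (Real.fourierChar (-(inner ℝ x ξ)) : ℂ) * g ξ ∂μ

theorem measurable_extension {k : ℕ} {μ : Measure (Euc k)} [IsFiniteMeasure μ] {g : Euc k → ℂ}
    (hg : Measurable g) : Measurable (extension μ g) := by
  have : Measurable fun p : Euc k × Euc k => (Real.fourierChar (-(inner ℝ p.1 p.2)) : ℂ) * g p.2 := by
    have : Continuous fun p : Euc k × Euc k => (Real.fourierChar (-(inner ℝ p.1 p.2)) : ℂ) := by
      fun_prop
    exact this.measurable.mul (hg.comp measurable_snd)
  exact this.stronglyMeasurable.integral_prod_right.measurable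

theorem norm_extension_le {k : ℕ} {μ : Measure (Euc k)} [IsFiniteMeasure μ] {g : Euc k → ℂ}
    (hg1 : ∀ ξ, ‖g ξ‖ ≤ 1) (x : Euc k) : ‖extension μ g x‖ ≤ μ.real univ := by
  refine (norm_integral_le_of_norm_le_const (C := 1)
    (Filter.Eventually.of_forall fun ξ => ?_)).trans (by simp)
  rw [norm_mul, Circle.norm_coe, one_mul]
  exact hg1 ξ

theorem integral_mul_normSq_extension {k : ℕ} {μ : Measure (Euc k)} [IsFiniteMeasure μ]
    {g : Euc k → ℂ} (hg : Measurable g) (hg1 : ∀ ξ, ‖g ξ‖ ≤ 1) {ψ : Euc k → ℂ}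
    (hψ : Integrable ψ) :
    ∫ x, ψ x * (extension μ g x * starRingEnd ℂ (extension μ g x))
      = ∫ p : Euc k × Euc k, (g p.1 * starRingEnd ℂ (g p.2)) * 𝓕 ψ (p.1 - p.2) ∂(μ.prod μ) := by
  have h1 : ∀ x, extension μ g x * starRingEnd ℂ (extension μ g x)
      = ∫ p : Euc k × Euc k, (g p.1 * starRingEnd ℂ (g p.2)) *
        (Real.fourierChar (-(inner ℝ x (p.1 - p.2))) : ℂ) ∂(μ.prod μ) := by
    intro x
    rw [extension, ← integral_conj, ← integral_prod_mul]
    congr 1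
    ext p
    have : (Real.fourierChar (-(inner ℝ x (p.1 - p.2))) : ℂ)
        = Real.fourierChar (-(inner ℝ x p.1)) * starRingEnd ℂ (Real.fourierChar (-(inner ℝ x p.2)) : ℂ) := by
      rw [inner_sub_right, ← Circle.coe_inv_eq_conj, ← AddChar.map_neg_eq_inv, ← Circle.coe_mul,
        ← AddChar.map_add_eq_mul]
      congr 2
      ring
    rw [this, map_mul]
    ring
  simp_rw [h1, ← integral_const_mul]
  rw [integral_integral_swap]
  · refine integral_congr_ae (Filter.Eventually.of_forall fun p => ?_)
    simp only
    rw [Real.fourier_eq, ← integral_const_mul]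
    congr 1
    ext x
    rw [Circle.smul_def, smul_eq_mul]
    ring
  · have hb : Integrable (fun z : Euc k × (Euc k × Euc k) => ‖ψ z.1‖ * 1) (volume.prod (μ.prod μ)) :=
      hψ.norm.mul_prod (integrable_const (1 : ℝ))
    refine hb.mono' ?_ (Filter.Eventually.of_forall fun z => ?_)
    · refine hψ.aestronglyMeasurable.comp_fst.mul (Measurable.aestronglyMeasurable ?_)
      have hc : Continuous fun z : Euc k × (Euc k × Euc k) =>
        (Real.fourierChar (-(inner ℝ z.1 (z.2.1 - z.2.2))) : ℂ) := by fun_prop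
      have hc' := hc.measurable
      have hstar : Measurable (starRingEnd ℂ) := Complex.continuous_conj.measurable
      have : Measurable fun z : Euc k × (Euc k × Euc k) => g z.2.1 * starRingEnd ℂ (g z.2.2) :=
        (hg.comp (by fun_prop)).mul (hstar.comp (hg.comp (by fun_prop)))
      exact this.mul hc'
    · simp only [Function.uncurry, norm_mul, RCLike.norm_conj, Circle.norm_coe, mul_one]
      have := hg1 z.2.1
      have := hg1 z.2.2
      calc ‖ψ z.1‖ * (‖g z.2.1‖ * ‖g z.2.2‖) ≤ ‖ψ z.1‖ * (1 * 1) := by gcongr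
        _ = _ := by ring

theorem lintegral_extension_pow_four_le {k : ℕ} {μ : Measure (Euc k)} [SigmaFinite μ] {A : ℝ≥0∞} {β : ℝ}
    (hμ : BilinearBound μ A β) {E : Set (Euc k)} (hE : MeasurableSet E) (hEt : μ E ≠ ∞)
    {g : Euc k → ℂ} (hg : Measurable g) (hg1 : ∀ ξ, ‖g ξ‖ ≤ 1) :
    ∫⁻ x, ‖extension (μ.restrict E) g x‖ₑ ^ 4 ≤ (A * μ E ^ β) ^ 2 := by
  have : IsFiniteMeasure (μ.restrict E) := ⟨by simpa using hEt.lt_top⟩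
  set G := extension (μ.restrict E) g with hG
  have hGm : Measurable G := measurable_extension hg
  set M := (μ.restrict E).real univ
  have hGM : ∀ x, ‖G x‖ ≤ M := norm_extension_le hg1
  have hM0 : 0 ≤ M := measureReal_nonneg
  have hball : ∀ R : ℕ, ∫⁻ x in Metric.ball 0 (R : ℝ), ‖G x‖ₑ ^ 4 ≤ (A * μ E ^ β) ^ 2 := by
    intro R
    set B : Set (Euc k) := Metric.ball 0 (R : ℝ)
    have hBm : MeasurableSet B := measurableSet_ball
    have hBt : volume B ≠ ∞ := measure_ball_lt_top.ne
    let ψ : Euc k → ℂ := B.indicator fun x => ((‖G x‖ ^ 2 : ℝ) : ℂ)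
    have hψm : Measurable ψ := Measurable.indicator (by fun_prop) hBm
    have hψ1 : Integrable ψ := by
      rw [integrable_indicator_iff hBm]
      refine IntegrableOn.of_bound hBt.lt_top (by fun_prop) (M ^ 2)
        (Filter.Eventually.of_forall fun x => ?_)
      rw [Complex.norm_real, Real.norm_of_nonneg (by positivity)]
      gcongr
      exact hGM x
    have hψ2 : MemLp ψ 2 := by
      rw [memLp_indicator_iff_restrict hBm]
      have : IsFiniteMeasure (volume.restrict B) := ⟨by simpa using hBt.lt_top⟩
      refine MemLp.of_bound (by fun_prop) (M ^ 2) (Filter.Eventually.of_forall fun x => ?_)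
      rw [Complex.norm_real, Real.norm_of_nonneg (by positivity)]
      gcongr
      exact hGM x
    set N := ∫⁻ x in B, ‖G x‖ₑ ^ 4 with hN
    have hi : IntegrableOn (fun x => ‖G x‖ ^ 4) B := by
      refine IntegrableOn.of_bound hBt.lt_top (by fun_prop) (M ^ 4)
        (Filter.Eventually.of_forall fun x => ?_)
      rw [Real.norm_of_nonneg (by positivity)]
      gcongr
      exact hGM x
    have e1 : N = ENNReal.ofReal (∫ x in B, ‖G x‖ ^ 4) := by
      rw [ofReal_integral_eq_lintegral_ofReal hi
        (Filter.Eventually.of_forall fun x => by positivity)]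
      refine lintegral_congr fun x => ?_
      rw [ENNReal.ofReal_pow (norm_nonneg _), ofReal_norm]
    have hNt : N ≠ ∞ := e1 ▸ ENNReal.ofReal_ne_top
    have hψsq : ∫⁻ x, ‖ψ x‖ₑ ^ 2 = N := by
      rw [hN, ← lintegral_indicator hBm]
      refine lintegral_congr fun x => ?_
      by_cases hx : x ∈ B
      · simp only [ψ, indicator_of_mem hx]
        rw [← ofReal_norm, Complex.norm_real, Real.norm_of_nonneg (by positivity),
          ENNReal.ofReal_pow (norm_nonneg _), ofReal_norm]
        ring
      · simp [ψ, indicator_of_notMem hx]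
    have hle : N ≤ A * μ E ^ β * N ^ (1 / 2 : ℝ) := by
      have e2 : ((∫ x in B, ‖G x‖ ^ 4 : ℝ) : ℂ) = ∫ x, ψ x * (G x * starRingEnd ℂ (G x)) := by
        rw [← integral_indicator hBm, ← integral_complex_ofReal]
        congr 1
        ext x
        by_cases hx : x ∈ B
        · simp only [ψ, indicator_of_mem hx]
          rw [Complex.mul_conj, Complex.normSq_eq_norm_sq]
          push_cast
          ring
        · simp [ψ, indicator_of_notMem hx]
      have hk : Measurable fun z => ‖𝓕 ψ z‖ := (continuous_fourier hψ1).norm.measurable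
      calc N = ‖∫ x, ψ x * (G x * starRingEnd ℂ (G x))‖ₑ := by
            rw [← e2, e1, ← ofReal_norm, Complex.norm_real, Real.norm_of_nonneg (by positivity)]
        _ ≤ ∫⁻ p : Euc k × Euc k, ‖(g p.1 * starRingEnd ℂ (g p.2)) * 𝓕 ψ (p.1 - p.2)‖ₑ
              ∂((μ.restrict E).prod (μ.restrict E)) := by
            rw [hG, integral_mul_normSq_extension hg hg1 hψ1]
            exact enorm_integral_le_lintegral_enorm _
        _ ≤ ∫⁻ p : Euc k × Euc k, ENNReal.ofReal (‖𝓕 ψ (p.1 - p.2)‖)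
              ∂((μ.restrict E).prod (μ.restrict E)) := by
            refine lintegral_mono fun p => ?_
            rw [← ofReal_norm]
            refine ENNReal.ofReal_le_ofReal ?_
            rw [norm_mul, norm_mul, RCLike.norm_conj]
            have := hg1 p.1
            have := hg1 p.2
            calc _ ≤ 1 * 1 * ‖𝓕 ψ (p.1 - p.2)‖ := by gcongr
              _ = _ := by ring
        _ = ∫⁻ u in E, ∫⁻ v in E, ENNReal.ofReal (‖𝓕 ψ (u - v)‖) ∂μ ∂μ :=
            lintegral_prod _ (by
              have : Measurable fun p : Euc k × Euc k => ‖𝓕 ψ (p.1 - p.2)‖ :=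
                hk.comp (by fun_prop)
              exact this.ennreal_ofReal.aemeasurable)
        _ ≤ A * μ E ^ β * (∫⁻ z, ENNReal.ofReal (‖𝓕 ψ z‖) ^ 2) ^ (1 / 2 : ℝ) :=
            hμ E hE hEt _ hk
        _ = A * μ E ^ β * N ^ (1 / 2 : ℝ) := by
            simp only [ofReal_norm]
            rw [lintegral_enorm_fourier_sq hψ1 hψ2, hψsq]
    rcases eq_or_ne N 0 with h0 | h0
    · rw [h0]; exact zero_le
    have hs0 : N ^ (1 / 2 : ℝ) ≠ 0 := by simp [ENNReal.rpow_eq_zero_iff, h0, hNt]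
    have hst : N ^ (1 / 2 : ℝ) ≠ ∞ := ENNReal.rpow_ne_top_of_ne_zero h0 hNt
    have hsq : N ^ (1 / 2 : ℝ) * N ^ (1 / 2 : ℝ) = N := by
      rw [← ENNReal.rpow_add _ _ h0 hNt]; norm_num
    have : N ^ (1 / 2 : ℝ) ≤ A * μ E ^ β := by
      rw [← ENNReal.mul_le_mul_iff_left hs0 hst, hsq]
      exact hle
    calc N = (N ^ (1 / 2 : ℝ)) ^ 2 := by rw [sq, hsq]
      _ ≤ _ := by gcongr
  have hmono : Monotone fun R : ℕ => Metric.ball (0 : Euc k) (R : ℝ) := fun a b hab =>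
    Metric.ball_subset_ball (by exact_mod_cast hab)
  have hun : ⋃ R : ℕ, Metric.ball (0 : Euc k) (R : ℝ) = univ := Metric.iUnion_ball_nat 0
  rw [← setLIntegral_univ, ← hun, setLIntegral_iUnion_of_directed _ hmono.directed_le]
  exact iSup_le hball

theorem eLpNorm_four_thirds {α : Type*} [MeasurableSpace α] (μ : Measure α) (f : α → ℂ) :
    eLpNorm f (4 / 3) μ = (∫⁻ x, ‖f x‖ₑ ^ (4 / 3 : ℝ) ∂μ) ^ (3 / 4 : ℝ) := by
  have h0 : (4 / 3 : ℝ≥0∞) ≠ 0 := by simp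
  have ht : (4 / 3 : ℝ≥0∞) ≠ ∞ := ENNReal.div_ne_top (by simp) (by simp)
  rw [eLpNorm_eq_lintegral_rpow_enorm_toReal h0 ht]
  simp

theorem setLIntegral_enorm_fourier_le {k : ℕ} {μ : Measure (Euc k)} [SigmaFinite μ] {A : ℝ≥0∞}
    {β : ℝ} (hμ : BilinearBound μ A β) {E : Set (Euc k)} (hE : MeasurableSet E) (hEt : μ E ≠ ∞)
    {f : Euc k → ℂ} (hf : Integrable f) :
    ∫⁻ ξ in E, ‖𝓕 f ξ‖ₑ ∂μ ≤ (A * μ E ^ β) ^ (1 / 2 : ℝ) * eLpNorm f (4 / 3) volume := by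
  have : IsFiniteMeasure (μ.restrict E) := ⟨by simpa using hEt.lt_top⟩
  have hFc := continuous_fourier hf
  let g : Euc k → ℂ := fun ξ => starRingEnd ℂ (𝓕 f ξ) / (‖𝓕 f ξ‖ : ℂ)
  have hg : Measurable g :=
    (Complex.continuous_conj.measurable.comp hFc.measurable).div
      (Complex.continuous_ofReal.comp hFc.norm).measurable
  have hg1 : ∀ ξ, ‖g ξ‖ ≤ 1 := fun ξ => by
    simp only [g, norm_div, RCLike.norm_conj, Complex.norm_real, norm_norm]
    exact div_self_le_one _
  have hgF : ∀ ξ, 𝓕 f ξ * g ξ = (‖𝓕 f ξ‖ : ℂ) := fun ξ => by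
    rcases eq_or_ne (𝓕 f ξ) 0 with h0 | h0
    · simp [h0]
    · have : (‖𝓕 f ξ‖ : ℂ) ≠ 0 := by simpa using h0
      simp only [g]
      rw [mul_div_assoc', Complex.mul_conj, Complex.normSq_eq_norm_sq]
      push_cast
      field_simp
  have hFb : ∀ ξ, ‖𝓕 f ξ‖ ≤ ∫ x, ‖f x‖ := fun ξ => by
    rw [Real.fourier_eq]
    refine (norm_integral_le_integral_norm _).trans (le_of_eq ?_)
    simp_rw [Circle.norm_smul]
  have hi : Integrable (fun ξ => ‖𝓕 f ξ‖) (μ.restrict E) :=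
    Integrable.of_bound hFc.norm.aestronglyMeasurable (∫ x, ‖f x‖)
      (Filter.Eventually.of_forall fun ξ => by simpa using hFb ξ)
  have hswap : ∫ ξ in E, 𝓕 f ξ * g ξ ∂μ = ∫ x, f x * extension (μ.restrict E) g x := by
    have h1 : ∀ ξ, 𝓕 f ξ * g ξ = ∫ x, f x * ((Real.fourierChar (-(inner ℝ x ξ)) : ℂ) * g ξ) := by
      intro ξ
      rw [Real.fourier_eq, ← integral_mul_const]
      congr 1
      ext x
      rw [Circle.smul_def, smul_eq_mul]
      ring
    simp_rw [h1]
    rw [integral_integral_swap]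
    · congr 1
      ext x
      rw [extension, ← integral_const_mul]
    · have hb : Integrable (fun z : Euc k × Euc k => 1 * ‖f z.2‖) ((μ.restrict E).prod volume) :=
        (integrable_const (1 : ℝ)).mul_prod hf.norm
      refine hb.mono' ?_ (Filter.Eventually.of_forall fun z => ?_)
      · refine hf.aestronglyMeasurable.comp_snd.mul (Measurable.aestronglyMeasurable ?_)
        have hc : Continuous fun z : Euc k × Euc k =>
          (Real.fourierChar (-(inner ℝ z.2 z.1)) : ℂ) := by fun_prop
        exact hc.measurable.mul (hg.comp measurable_fst)
      · simp only [Function.uncurry, norm_mul, Circle.norm_coe, one_mul]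
        exact mul_le_of_le_one_right (norm_nonneg _) (hg1 z.1)
  have h43 : (4 / 3 : ℝ).HolderConjugate 4 := by
    rw [Real.holderConjugate_iff]; norm_num
  calc ∫⁻ ξ in E, ‖𝓕 f ξ‖ₑ ∂μ = ENNReal.ofReal (∫ ξ in E, ‖𝓕 f ξ‖ ∂μ) := by
        rw [ofReal_integral_eq_lintegral_ofReal hi
          (Filter.Eventually.of_forall fun x => norm_nonneg _)]
        simp
    _ = ‖∫ ξ in E, 𝓕 f ξ * g ξ ∂μ‖ₑ := by
        simp_rw [hgF]
        rw [integral_complex_ofReal, ← ofReal_norm, Complex.norm_real,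
          Real.norm_of_nonneg (integral_nonneg fun _ => norm_nonneg _)]
    _ ≤ ∫⁻ x, ‖f x * extension (μ.restrict E) g x‖ₑ := by
        rw [hswap]
        exact enorm_integral_le_lintegral_enorm _
    _ = ∫⁻ x, ((fun x => ‖f x‖ₑ) * fun x => ‖extension (μ.restrict E) g x‖ₑ) x := by
        simp [enorm_mul]
    _ ≤ (∫⁻ x, ‖f x‖ₑ ^ (4 / 3 : ℝ)) ^ (1 / (4 / 3) : ℝ) *
          (∫⁻ x, ‖extension (μ.restrict E) g x‖ₑ ^ (4 : ℝ)) ^ (1 / 4 : ℝ) :=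
        ENNReal.lintegral_mul_le_Lp_mul_Lq volume h43 hf.aestronglyMeasurable.enorm
          (measurable_extension hg).enorm.aemeasurable
    _ ≤ eLpNorm f (4 / 3) volume * ((A * μ E ^ β) ^ 2) ^ (1 / 4 : ℝ) := by
        have e1 : ∫⁻ x, ‖extension (μ.restrict E) g x‖ₑ ^ (4 : ℝ)
            = ∫⁻ x, ‖extension (μ.restrict E) g x‖ₑ ^ 4 := by
          refine lintegral_congr fun x => ?_
          rw [← ENNReal.rpow_natCast]
          norm_num
        rw [eLpNorm_four_thirds, e1]
        have e2 : (1 / (4 / 3) : ℝ) = 3 / 4 := by norm_num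
        rw [e2]
        gcongr
        exact lintegral_extension_pow_four_le hμ hE hEt hg hg1
    _ = _ := by
        rw [mul_comm, ← ENNReal.rpow_natCast, ← ENNReal.rpow_mul]
        norm_num

/-! ### From integrals over sets of finite measure to the weak norm -/

theorem weakNorm_le {α : Type*} [MeasurableSpace α] {μ : Measure α} [SigmaFinite μ] {g : α → ℂ}
    (hg : StronglyMeasurable g) {q : ℝ} (hq : 0 < q) {B : ℝ≥0∞}
    (h : ∀ E, MeasurableSet E → μ E ≠ ∞ → ∫⁻ x in E, ‖g x‖ₑ ∂μ ≤ B * μ E ^ (1 - 1 / q)) :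
    weakNorm g q μ ≤ B := by
  refine iSup_le fun t => ?_
  set S := {x | t < ‖g x‖₊} with hS
  have hSm : MeasurableSet S := measurableSet_lt measurable_const hg.measurable.nnnorm
  have hfin : ∀ i, (t : ℝ≥0∞) * μ (S ∩ spanningSets μ i) ^ (1 / q) ≤ B := by
    intro i
    set E := S ∩ spanningSets μ i
    have hEm : MeasurableSet E := hSm.inter (measurableSet_spanningSets μ i)
    have hEt : μ E ≠ ∞ :=
      ((measure_mono inter_subset_right).trans_lt (measure_spanningSets_lt_top μ i)).ne
    rcases eq_or_ne (μ E) 0 with h0 | h0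
    · rw [h0, ENNReal.zero_rpow_of_pos (by positivity), mul_zero]
      exact zero_le
    have h1 : (t : ℝ≥0∞) * μ E ≤ B * μ E ^ (1 - 1 / q) := by
      refine le_trans ?_ (h E hEm hEt)
      rw [← setLIntegral_const]
      refine setLIntegral_mono' hEm fun x hx => ?_
      have : t < ‖g x‖₊ := hx.1
      rw [enorm_eq_nnnorm]
      exact_mod_cast this.le
    have hp0 : μ E ^ (1 - 1 / q) ≠ 0 := by simp [ENNReal.rpow_eq_zero_iff, h0, hEt]
    have hpt : μ E ^ (1 - 1 / q) ≠ ∞ := ENNReal.rpow_ne_top_of_ne_zero h0 hEt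
    rw [← ENNReal.mul_le_mul_iff_left hp0 hpt, mul_assoc, ← ENNReal.rpow_add _ _ h0 hEt]
    simpa using h1
  have hmono : Monotone fun i => S ∩ spanningSets μ i := fun i j hij =>
    inter_subset_inter_right _ (monotone_spanningSets μ hij)
  have hun : ⋃ i, S ∩ spanningSets μ i = S := by
    rw [← inter_iUnion, iUnion_spanningSets, inter_univ]
  have hlim : Filter.Tendsto (fun i => (t : ℝ≥0∞) * μ (S ∩ spanningSets μ i) ^ (1 / q)) Filter.atTop
      (𝓝 ((t : ℝ≥0∞) * μ S ^ (1 / q))) := by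
    refine ENNReal.Tendsto.const_mul ?_ (Or.inr ENNReal.coe_ne_top)
    have := tendsto_measure_iUnion_atTop (μ := μ) hmono
    rw [hun] at this
    exact (ENNReal.continuous_rpow_const.tendsto _).comp this
  exact le_of_tendsto' hlim hfin

/-! ### Extension by density -/

/-- A σ-finite measure is equivalent to a measure `ν` for which the bounds
`∫_E ‖g‖ dμ ≤ B μ(E)^θ`, for all sets `E` of finite measure, give `∫ ‖g‖ dν ≤ B`. -/
theorem exists_equivalent_measure {α : Type*} [MeasurableSpace α] (μ : Measure α) [SigmaFinite μ]
    {D : Set α → ℝ≥0∞} (hD : ∀ E, MeasurableSet E → μ E ≠ ∞ → D E ≠ ∞) :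
    ∃ ν : Measure α, μ ≪ ν ∧ ν ≪ μ ∧ ∀ (g : α → ℝ≥0∞) (B : ℝ≥0∞),
      (∀ E, MeasurableSet E → μ E ≠ ∞ → ∫⁻ x in E, g x ∂μ ≤ D E * B) → ∫⁻ x, g x ∂ν ≤ B := by
  have hS : ∀ i, MeasurableSet (spanningSets μ i) := measurableSet_spanningSets μ
  have hSt : ∀ i, μ (spanningSets μ i) ≠ ∞ := fun i => (measure_spanningSets_lt_top μ i).ne
  obtain ⟨δ, hδ0, hδ⟩ := ENNReal.exists_pos_tsum_mul_lt_of_countable (ε := 1) one_ne_zero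
    (fun i => D (spanningSets μ i)) fun i => hD _ (hS i) (hSt i)
  refine ⟨Measure.sum fun i => (δ i : ℝ≥0∞) • μ.restrict (spanningSets μ i), ?_, ?_, ?_⟩
  · refine Measure.AbsolutelyContinuous.mk fun s hs h0 => ?_
    rw [Measure.sum_apply _ hs, ENNReal.tsum_eq_zero] at h0
    have : ∀ i, μ (s ∩ spanningSets μ i) = 0 := by
      intro i
      have h1 := h0 i
      rw [Measure.smul_apply, smul_eq_mul, mul_eq_zero, Measure.restrict_apply hs] at h1
      exact h1.resolve_left (by exact_mod_cast (hδ0 i).ne')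
    have h2 : s = ⋃ i, s ∩ spanningSets μ i := by
      rw [← inter_iUnion, iUnion_spanningSets, inter_univ]
    rw [h2]
    exact measure_iUnion_null this
  · refine Measure.absolutelyContinuous_sum_left fun i => ?_
    exact (Measure.smul_absolutelyContinuous).trans Measure.absolutelyContinuous_restrict
  · intro g B hg
    rw [lintegral_sum_measure]
    calc ∑' i, ∫⁻ x, g x ∂((δ i : ℝ≥0∞) • μ.restrict (spanningSets μ i))
        ≤ ∑' i, D (spanningSets μ i) * δ i * B := by
          refine ENNReal.tsum_le_tsum fun i => ?_
          rw [lintegral_smul_measure, smul_eq_mul]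
          calc _ ≤ (δ i : ℝ≥0∞) * (D (spanningSets μ i) * B) := by
                gcongr
                exact hg _ (hS i) (hSt i)
            _ = _ := by ring
      _ = (∑' i, D (spanningSets μ i) * δ i) * B := ENNReal.tsum_mul_right
      _ ≤ 1 * B := by gcongr
      _ = B := one_mul B

theorem four_thirds_one_le : (1 : ℝ≥0∞) ≤ 4 / 3 := by
  rw [ENNReal.le_div_iff_mul_le (by simp) (by simp)]
  norm_num

theorem fourier_add_of_integrable {k : ℕ} {f g : Euc k → ℂ} (hf : Integrable f) (hg : Integrable g) :
    𝓕 (f + g) = 𝓕 f + 𝓕 g :=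
  VectorFourier.fourierIntegral_add Real.continuous_fourierChar (innerSL ℝ).continuous₂ hf hg

theorem fourier_const_smul {k : ℕ} (c : ℂ) (f : Euc k → ℂ) : 𝓕 (c • f) = c • 𝓕 f :=
  VectorFourier.fourierIntegral_const_smul _ _ _ f c

/-- A bound for the Fourier integral on `L^1 ∩ L^(4/3)` extends to `L^(4/3)`. -/
theorem exists_linear_extension {k : ℕ} (μ : Measure (Euc k)) [SigmaFinite μ] {D : Set (Euc k) → ℝ≥0∞}
    (hD : ∀ E, MeasurableSet E → μ E ≠ ∞ → D E ≠ ∞)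
    (hF : ∀ f : Euc k → ℂ, Integrable f → ∀ E, MeasurableSet E → μ E ≠ ∞ →
      ∫⁻ ξ in E, ‖𝓕 f ξ‖ₑ ∂μ ≤ D E * eLpNorm f (4 / 3) volume) :
    ∃ R : Lp ℂ (4 / 3) (volume : Measure (Euc k)) →ₗ[ℂ] (Euc k →ₘ[μ] ℂ),
      (∀ f : Lp ℂ (4 / 3) (volume : Measure (Euc k)), Integrable f volume →
        (R f : Euc k → ℂ) =ᵐ[μ] 𝓕 (f : Euc k → ℂ)) ∧
      ∀ f : Lp ℂ (4 / 3) (volume : Measure (Euc k)), ∀ E, MeasurableSet E → μ E ≠ ∞ →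
        ∫⁻ ξ in E, ‖R f ξ‖ₑ ∂μ ≤ D E * eLpNorm f (4 / 3) volume := by
  have hp1 : Fact ((1 : ℝ≥0∞) ≤ 4 / 3) := ⟨four_thirds_one_le⟩
  have hpt : (4 / 3 : ℝ≥0∞) ≠ ∞ := ENNReal.div_ne_top (by simp) (by simp)
  obtain ⟨ν, hμν, hνμ, hν⟩ := exists_equivalent_measure μ hD
  have hFν : ∀ f : Euc k → ℂ, Integrable f →
      ∫⁻ ξ, ‖𝓕 f ξ‖ₑ ∂ν ≤ eLpNorm f (4 / 3) volume := fun f hf => hν _ _ (hF f hf)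
  let W : Submodule ℂ (Lp ℂ (4 / 3) (volume : Measure (Euc k))) :=
    { carrier := {f | Integrable f volume}
      add_mem' := fun {f g} hf hg => by
        have hf : Integrable f volume := hf
        have hg : Integrable g volume := hg
        exact (hf.add hg).congr (Lp.coeFn_add f g).symm
      zero_mem' := (integrable_zero _ _ _).congr (Lp.coeFn_zero ℂ (4 / 3) volume).symm
      smul_mem' := fun c f hf => by
        have hf : Integrable f volume := hf
        exact (hf.smul c).congr (Lp.coeFn_smul c f).symm }
  have hWi : ∀ f : W, Integrable (f : Lp ℂ (4 / 3) (volume : Measure (Euc k))) volume := fun f => f.2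
  have hmem : ∀ f : W, MemLp (𝓕 ((f : Lp ℂ (4 / 3) (volume : Measure (Euc k))) : Euc k → ℂ)) 1 ν := by
    intro f
    refine memLp_one_iff_integrable.2 ⟨(continuous_fourier (hWi f)).aestronglyMeasurable, ?_⟩
    exact (hFν _ (hWi f)).trans_lt (Lp.memLp _).eLpNorm_lt_top
  let T : W →ₗ[ℂ] Lp ℂ 1 ν :=
    { toFun := fun f => (hmem f).toLp _
      map_add' := fun f g => by
        rw [← MemLp.toLp_add]
        refine MemLp.toLp_congr _ _ (Filter.Eventually.of_forall fun ξ => ?_)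
        rw [← fourier_add_of_integrable (hWi f) (hWi g)]
        exact Real.fourier_congr_ae (Lp.coeFn_add _ _) ξ
      map_smul' := fun c f => by
        rw [RingHom.id_apply, ← MemLp.toLp_const_smul]
        refine MemLp.toLp_congr _ _ (Filter.Eventually.of_forall fun ξ => ?_)
        rw [← fourier_const_smul]
        exact Real.fourier_congr_ae (Lp.coeFn_smul _ _) ξ }
  have hTnorm : ∀ f : W, ‖T f‖ ≤ 1 * ‖W.subtype f‖ := by
    intro f
    rw [one_mul]
    have h1 : ‖T f‖ = (eLpNorm (𝓕 ((f : Lp ℂ (4 / 3) (volume : Measure (Euc k))) : Euc k → ℂ))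
      1 ν).toReal := Lp.norm_toLp _ (hmem f)
    rw [h1, Submodule.subtype_apply, Lp.norm_def]
    refine ENNReal.toReal_mono (Lp.memLp _).eLpNorm_ne_top ?_
    rw [eLpNorm_one_eq_lintegral_enorm]
    exact hFν _ (hWi f)
  have hdense : DenseRange W.subtype := by
    refine (SchwartzMap.denseRange_toLpCLM (F := ℂ) (E := Euc k) (μ := volume) (p := 4 / 3) hpt).mono ?_
    rintro _ ⟨φ, rfl⟩
    refine ⟨⟨_, ?_⟩, rfl⟩
    exact φ.integrable.congr (φ.coeFn_toLp (4 / 3) volume).symm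
  let S : Lp ℂ (4 / 3) (volume : Measure (Euc k)) →L[ℂ] Lp ℂ 1 ν := T.extendOfNorm W.subtype
  have hST : ∀ f : W, S f = T f := fun f => LinearMap.extendOfNorm_eq hdense ⟨1, hTnorm⟩ f
  have hsm : ∀ f, AEStronglyMeasurable (S f) μ := fun f =>
    (Lp.aestronglyMeasurable (S f)).mono_ac hμν
  let R : Lp ℂ (4 / 3) (volume : Measure (Euc k)) →ₗ[ℂ] (Euc k →ₘ[μ] ℂ) :=
    { toFun := fun f => AEEqFun.mk (S f) (hsm f)
      map_add' := fun f g => by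
        rw [AEEqFun.mk_add_mk, AEEqFun.mk_eq_mk, map_add]
        exact hμν.ae_eq (Lp.coeFn_add _ _)
      map_smul' := fun c f => by
        rw [RingHom.id_apply, AEEqFun.smul_mk, AEEqFun.mk_eq_mk, map_smul]
        exact hμν.ae_eq (Lp.coeFn_smul _ _) }
  have hR : ∀ f, (R f : Euc k → ℂ) =ᵐ[μ] S f := fun f => AEEqFun.coeFn_mk _ _
  have hRW : ∀ f : W, (R f : Euc k → ℂ) =ᵐ[μ]
      𝓕 ((f : Lp ℂ (4 / 3) (volume : Measure (Euc k))) : Euc k → ℂ) := by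
    intro f
    refine (hR f).trans (hμν.ae_eq ?_)
    rw [hST]
    exact (hmem f).coeFn_toLp
  refine ⟨R, fun f hf => hRW ⟨f, hf⟩, fun f E hE hEt => ?_⟩
  have hf : f ∈ closure (range W.subtype) := hdense f
  obtain ⟨F, hF1, hF2⟩ := mem_closure_iff_seq_limit.1 hf
  choose G hG using hF1
  have hlim : Filter.Tendsto (fun i => S (F i)) Filter.atTop (𝓝 (S f)) :=
    (S.continuous.tendsto f).comp hF2
  obtain ⟨ns, hns, hae⟩ := (tendstoInMeasure_of_tendsto_Lp hlim).exists_seq_tendsto_ae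
  have hae' : ∀ᵐ ξ ∂(μ.restrict E), Filter.Tendsto (fun i => R (F (ns i)) ξ) Filter.atTop (𝓝 (R f ξ)) := by
    refine ae_restrict_of_ae ?_
    filter_upwards [hμν.ae_le hae, ae_all_iff.2 fun i => hR (F (ns i)), hR f] with ξ h1 h2 h3
    rw [h3]
    simp_rw [h2]
    exact h1
  have hnorm : Filter.Tendsto (fun i => eLpNorm (F (ns i)) (4 / 3) volume) Filter.atTop
      (𝓝 (eLpNorm f (4 / 3) volume)) := by
    have h1 := (hF2.comp hns.tendsto_atTop).enorm
    simpa [Lp.enorm_def] using h1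
  calc ∫⁻ ξ in E, ‖R f ξ‖ₑ ∂μ
      = ∫⁻ ξ in E, Filter.liminf (fun i => ‖R (F (ns i)) ξ‖ₑ) Filter.atTop ∂μ := by
        refine lintegral_congr_ae ?_
        filter_upwards [hae'] with ξ hξ
        exact hξ.enorm.liminf_eq.symm
    _ ≤ Filter.liminf (fun i => ∫⁻ ξ in E, ‖R (F (ns i)) ξ‖ₑ ∂μ) Filter.atTop :=
        lintegral_liminf_le fun i => (AEEqFun.measurable _).enorm
    _ ≤ Filter.liminf (fun i => D E * eLpNorm (F (ns i)) (4 / 3) volume) Filter.atTop := by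
        refine Filter.liminf_le_liminf (Filter.Eventually.of_forall fun i => ?_)
        have h1 : ∫⁻ ξ in E, ‖R (F (ns i)) ξ‖ₑ ∂μ = ∫⁻ ξ in E, ‖𝓕 (F (ns i) : Euc k → ℂ) ξ‖ₑ ∂μ := by
          refine lintegral_congr_ae (ae_restrict_of_ae ?_)
          have := hRW (G (ns i))
          rw [show ((G (ns i) : W) : Lp ℂ (4 / 3) (volume : Measure (Euc k))) = F (ns i) from
            hG (ns i)] at this
          filter_upwards [this] with ξ hξ
          rw [hξ]
        rw [h1]
        refine hF _ ?_ E hE hEt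
        rw [← hG (ns i)]
        exact hWi (G (ns i))
    _ = D E * eLpNorm f (4 / 3) volume :=
        (ENNReal.Tendsto.const_mul hnorm (Or.inr (hD E hE hEt))).liminf_eq

theorem restrictionEstimate_of_bilinearBound {k : ℕ} {μ : Measure (Euc k)} [SigmaFinite μ] {A : ℝ≥0}
    {q : ℝ} (hq : 1 < q) (hμ : BilinearBound μ A (2 * (1 - 1 / q))) {C : ℝ≥0}
    (hC : A ^ (1 / 2 : ℝ) ≤ C) :
    RestrictionEstimate μ (4 / 3) q C := by
  have hq0 : 0 < q := one_pos.trans hq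
  have hθ : 0 ≤ 1 - 1 / q := by
    rw [sub_nonneg, div_le_one hq0]
    exact hq.le
  have hC' : (A : ℝ≥0∞) ^ (1 / 2 : ℝ) ≤ C := by
    rw [← ENNReal.coe_rpow_of_nonneg _ (by norm_num)]
    exact_mod_cast hC
  obtain ⟨R, hR1, hR2⟩ := exists_linear_extension μ
    (D := fun E => (A * μ E ^ (2 * (1 - 1 / q))) ^ (1 / 2 : ℝ))
    (fun E _ hEt => ENNReal.rpow_ne_top_of_nonneg (by norm_num)
      (ENNReal.mul_ne_top ENNReal.coe_ne_top (ENNReal.rpow_ne_top_of_nonneg (by positivity) hEt)))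
    (fun f hf E hE hEt => setLIntegral_enorm_fourier_le hμ hE hEt hf)
  refine ⟨R, hR1, fun f => weakNorm_le (AEEqFun.stronglyMeasurable _) hq0 fun E hE hEt => ?_⟩
  refine (hR2 f E hE hEt).trans ?_
  rw [ENNReal.mul_rpow_of_nonneg _ _ (by norm_num), ← ENNReal.rpow_mul]
  have : 2 * (1 - 1 / q) * (1 / 2) = 1 - 1 / q := by ring
  rw [this]
  calc _ = (A : ℝ≥0∞) ^ (1 / 2 : ℝ) * eLpNorm f (4 / 3) volume * μ E ^ (1 - 1 / q) := by ring
    _ ≤ _ := by gcongr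

theorem GenericMultiplicityLE.congr {α β : Type*} [MeasureSpace β] {Φ Φ' : α → β} {s : Set α}
    {l : ℕ} (h : GenericMultiplicityLE Φ s l) (heq : EqOn Φ Φ' s) :
    GenericMultiplicityLE Φ' s l := by
  filter_upwards [h] with y hy
  convert hy using 2
  ext x
  simp only [mem_inter_iff, mem_preimage, mem_singleton_iff, and_congr_right_iff]
  intro hx
  rw [heq hx]

theorem genericMultiplicityLE_of_injective {α α' β β' : Type*} [MeasureSpace β] [MeasureSpace β']
    {Φ : α → β} {F : α' → β'} {S : α → α'} {T : β → β'} (hS : Function.Injective S)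
    (hT : MeasurePreserving T) (hFS : ∀ x, F (S x) = T (Φ x)) {m : ℕ}
    (h : ∀ᵐ y, {x | F x = y}.encard ≤ (m : ℕ∞)) (s : Set α) : GenericMultiplicityLE Φ s m := by
  filter_upwards [hT.quasiMeasurePreserving.ae h] with y hy
  rw [← hS.encard_image]
  refine (encard_le_encard ?_).trans hy
  rintro _ ⟨x, ⟨-, hx⟩, rfl⟩
  rw [mem_preimage, mem_singleton_iff] at hx
  rw [mem_ofPred_eq, hFS, hx]

theorem affineSurfaceMeasure_congr {n : ℕ} {Ω : Set (Euc n)} (hΩ : IsOpen Ω) {φ φ' : Euc n → ℝ}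
    (h : EqOn φ φ' Ω) : affineSurfaceMeasure Ω φ = affineSurfaceMeasure Ω φ' := by
  have h1 : ∀ x ∈ Ω, φ =ᶠ[𝓝 x] φ' := fun x hx => h.eventuallyEq_of_mem (hΩ.mem_nhds hx)
  have h2 : ∀ x ∈ Ω, gradient φ =ᶠ[𝓝 x] gradient φ' := fun x hx => by
    filter_upwards [hΩ.mem_nhds hx] with y hy
    exact (h1 y hy).gradient_eq
  have h3 : ∀ x ∈ Ω, hessianDet φ x = hessianDet φ' x := fun x hx => by
    simp only [hessianDet, (h2 x hx).fderiv_eq]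
  unfold affineSurfaceMeasure
  rw [withDensity_congr_ae (g := fun x =>
    ENNReal.ofReal (|hessianDet φ' x| ^ (1 / ((n : ℝ) + 2))))]
  · refine Measure.map_congr ((withDensity_absolutelyContinuous _ _).ae_le ?_)
    filter_upwards [ae_restrict_mem hΩ.measurableSet] with x hx
    simp only [graphMap, h hx]
  · filter_upwards [ae_restrict_mem hΩ.measurableSet] with x hx
    rw [h3 x hx]

theorem restrictionEstimate_affineSurfaceMeasure {n : ℕ} (hn : 2 ≤ n) (l m : ℕ)
    {Ω : Set (Euc n)} {φ : Euc n → ℝ} (hΩ : IsOpen Ω) (hφ : ContDiffOn ℝ 2 φ Ω)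
    (hl : GenericMultiplicityLE (gradient φ) Ω l)
    (hm : GenericMultiplicityLE (diffMap φ) (powSet Ω) m) :
    RestrictionEstimate (affineSurfaceMeasure Ω φ) (4 / 3) (4 * (n : ℝ) / ((n : ℝ) + 2))
      ((bilinearConst n l m).toNNReal ^ (1 / 2 : ℝ) + 1) := by
  have heq : EqOn φ (Ω.indicator φ) Ω := fun x hx => (indicator_of_mem hx φ).symm
  have hφm : Measurable (Ω.indicator φ) := by
    classical
    rw [← piecewise_eq_indicator]
    exact hφ.continuousOn.measurable_piecewise continuousOn_const hΩ.measurableSet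
  have hgrad : EqOn (gradient φ) (gradient (Ω.indicator φ)) Ω := fun x hx =>
    (heq.eventuallyEq_of_mem (hΩ.mem_nhds hx)).gradient_eq
  have hdiff : EqOn (diffMap φ) (diffMap (Ω.indicator φ)) (powSet Ω) := fun X hX => by
    ext1 j
    simp only [diffMap, graphMap, heq (hX 0), heq (hX j.succ)]
  have hn' : (2 : ℝ) ≤ n := by exact_mod_cast hn
  rw [affineSurfaceMeasure_congr hΩ heq]
  have := sigmaFinite_affineSurfaceMeasure Ω hφm
  refine restrictionEstimate_of_bilinearBound (A := (bilinearConst n l m).toNNReal) ?_ ?_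
    (by simp)
  · rw [lt_div_iff₀ (by positivity)]
    linarith
  · intro E hE hEt h hh
    have e : 2 * (1 - 1 / (4 * (n : ℝ) / ((n : ℝ) + 2))) = 3 / 2 - 1 / n := by
      field_simp
      ring
    rw [e, ENNReal.coe_toNNReal (bilinearConst_ne_top hn l m)]
    exact lintegral_lintegral_affineSurfaceMeasure_le hn hΩ (hφ.congr fun x hx => (heq hx).symm)
      hφm (hl.congr hgrad) (hm.congr hdiff) hE hEt hh

theorem hasFDerivAt_eval {n : ℕ} (P : MvPolynomial (Fin n) ℝ) (x : Euc n) :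
    HasFDerivAt (fun x : Euc n => MvPolynomial.eval (fun i => x i) P)
      (∑ i, MvPolynomial.eval (fun i => x i) (MvPolynomial.pderiv i P) •
        (EuclideanSpace.proj i : Euc n →L[ℝ] ℝ)) x := by
  induction P using MvPolynomial.induction_on with
  | C a => simpa using hasFDerivAt_const a x
  | add p q hp hq =>
    simp only [map_add, add_smul, Finset.sum_add_distrib]
    exact hp.add hq
  | mul_X p j hp =>
    have hj : HasFDerivAt (fun x : Euc n => x j) (EuclideanSpace.proj j : Euc n →L[ℝ] ℝ) x :=
      (EuclideanSpace.proj j : Euc n →L[ℝ] ℝ).hasFDerivAt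
    simp only [map_mul, MvPolynomial.eval_X]
    refine (hp.mul hj).congr_fderiv ?_
    simp only [Derivation.leibniz, MvPolynomial.pderiv_X, smul_eq_mul, map_add, map_mul,
      MvPolynomial.eval_X, add_smul, Finset.sum_add_distrib, Finset.smul_sum, smul_smul]
    congr 1
    rw [Finset.sum_eq_single j]
    · simp
    · intro i _ hi
      simp [hi]
    · simp

theorem gradient_eval {n : ℕ} (P : MvPolynomial (Fin n) ℝ) (x : Euc n) (i : Fin n) :
    gradient (fun x : Euc n => MvPolynomial.eval (fun i => x i) P) x i =
      MvPolynomial.eval (fun i => x i) (MvPolynomial.pderiv i P) := by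
  rw [gradient_apply, (hasFDerivAt_eval P x).fderiv]
  simp

theorem contDiff_eval {n : ℕ} (P : MvPolynomial (Fin n) ℝ) :
    ContDiff ℝ 2 (fun x : Euc n => MvPolynomial.eval (fun i => x i) P) := by
  induction P using MvPolynomial.induction_on with
  | C a => simpa using contDiff_const
  | add p q hp hq => simpa using hp.add hq
  | mul_X p j hp =>
    simpa using hp.mul (EuclideanSpace.proj j : Euc n →L[ℝ] ℝ).contDiff

theorem totalDegree_pderiv_le {σ : Type*} (i : σ) (P : MvPolynomial σ ℝ) :
    (MvPolynomial.pderiv i P).totalDegree ≤ P.totalDegree := by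
  classical
  conv_lhs => rw [P.as_sum, map_sum]
  refine MvPolynomial.totalDegree_finsetSum_le fun s hs => ?_
  rw [MvPolynomial.pderiv_monomial]
  refine (MvPolynomial.totalDegree_monomial_le _ _).trans
    (le_trans ?_ (MvPolynomial.le_totalDegree hs))
  exact Finsupp.degree_mono tsub_le_self

theorem exists_genericMultiplicityLE_gradient_eval (n N : ℕ) :
    ∃ l, ∀ P : MvPolynomial (Fin n) ℝ, P.totalDegree ≤ N → ∀ Ω : Set (Euc n),
      GenericMultiplicityLE (gradient fun x : Euc n => MvPolynomial.eval (fun i => x i) P) Ω l := by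
  obtain ⟨l, hl⟩ := exists_ae_encard_fiber_le (Fin n) N
  refine ⟨l, fun P hP => ?_⟩
  refine genericMultiplicityLE_of_injective
    (F := fun (x : Fin n → ℝ) j => MvPolynomial.eval x (MvPolynomial.pderiv j P))
    (WithLp.ofLp_injective 2) (PiLp.volume_preserving_ofLp (Fin n)) ?_ ?_
  · intro x
    ext j
    exact (gradient_eval P x j).symm
  · filter_upwards [hl _ fun j => (totalDegree_pderiv_le j P).trans hP] with y hy
    simpa [funext_iff] using hy

theorem exists_genericMultiplicityLE_diffMap_eval (n N : ℕ) :
    ∃ m, ∀ P : MvPolynomial (Fin n) ℝ, P.totalDegree ≤ N → ∀ s : Set (Fin (n + 1) → Euc n),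
      GenericMultiplicityLE (diffMap fun x : Euc n => MvPolynomial.eval (fun i => x i) P) s m := by
  obtain ⟨m, hm⟩ := exists_ae_encard_fiber_le (Fin n × Fin (n + 1)) (max N 1)
  refine ⟨m, fun P hP => ?_⟩
  let G : Fin (n + 1) → Fin (n + 1) → MvPolynomial (Fin n × Fin (n + 1)) ℝ := fun k =>
    Fin.snoc (α := fun _ => MvPolynomial (Fin n × Fin (n + 1)) ℝ)
      (fun i => MvPolynomial.X (i, k)) (MvPolynomial.rename (fun i => (i, k)) P)
  have hG : ∀ k c, (G k c).totalDegree ≤ max N 1 := by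
    intro k c
    refine Fin.lastCases ?_ (fun i => ?_) c
    · simpa [G] using Or.inl ((MvPolynomial.totalDegree_rename_le _ P).trans hP)
    · simp [G]
  have hT : MeasurePreserving (fun (y : Fin n → Euc (n + 1)) (p : Fin n × Fin (n + 1)) =>
      y p.1 p.2) :=
    (measurePreserving_uncurry (ι := Fin n) (κ := Fin (n + 1)) (volume : Measure ℝ)).comp
      (volume_preserving_pi fun _ => PiLp.volume_preserving_ofLp (Fin (n + 1)))
  refine genericMultiplicityLE_of_injective
    (F := fun (x : Fin n × Fin (n + 1) → ℝ) p =>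
      MvPolynomial.eval x (G 0 p.2 - G p.1.succ p.2))
    (S := fun X p => X p.2 p.1) ?_ hT ?_ ?_
  · intro X Y hXY
    ext k i
    exact congr_fun hXY (i, k)
  · intro X
    ext ⟨j, c⟩
    refine Fin.lastCases ?_ (fun i => ?_) c
    · simp [G, diffMap, graphMap, MvPolynomial.eval_rename, Function.comp_def]
    · simp [G, diffMap, graphMap]
  · filter_upwards [hm (fun p => G 0 p.2 - G p.1.succ p.2) fun p =>
      (MvPolynomial.totalDegree_sub _ _).trans (max_le (hG _ _) (hG _ _))] with y hy
    simpa [funext_iff] using hy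

end AffineRestriction

theorem mainTheorem1 (n : ℕ) (hn : 2 ≤ n) :
    (∀ l m : ℕ, ∃ C : ℝ≥0, 0 < C ∧
      ∀ (Ω : Set (AffineRestriction.Euc n)) (φ : AffineRestriction.Euc n → ℝ),
        IsOpen Ω → ContDiffOn ℝ 2 φ Ω →
        AffineRestriction.GenericMultiplicityLE (gradient φ) Ω l →
        AffineRestriction.GenericMultiplicityLE (AffineRestriction.diffMap φ)
          (AffineRestriction.powSet Ω) m →
        AffineRestriction.RestrictionEstimate
          (AffineRestriction.affineSurfaceMeasure Ω φ) (4 / 3)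
          (4 * (n : ℝ) / ((n : ℝ) + 2)) C) ∧
    (∀ N : ℕ, ∃ C : ℝ≥0, 0 < C ∧
      ∀ (Ω : Set (AffineRestriction.Euc n)) (P : MvPolynomial (Fin n) ℝ),
        IsOpen Ω → P.totalDegree ≤ N →
        AffineRestriction.RestrictionEstimate
          (AffineRestriction.affineSurfaceMeasure Ω (fun x => MvPolynomial.eval (fun i => x i) P))
          (4 / 3) (4 * (n : ℝ) / ((n : ℝ) + 2)) C) := by
  refine ⟨fun l m => ⟨_, by positivity, fun Ω φ hΩ hφ hl hm =>
    AffineRestriction.restrictionEstimate_affineSurfaceMeasure hn l m hΩ hφ hl hm⟩, fun N => ?_⟩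
  obtain ⟨l, hl⟩ := AffineRestriction.exists_genericMultiplicityLE_gradient_eval n N
  obtain ⟨m, hm⟩ := AffineRestriction.exists_genericMultiplicityLE_diffMap_eval n N
  exact ⟨_, by positivity, fun Ω P hΩ hP =>
    AffineRestriction.restrictionEstimate_affineSurfaceMeasure hn l m hΩ
      (AffineRestriction.contDiff_eval P).contDiffOn (hl P hP Ω) (hm P hP _)⟩
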